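/- Let $\Bbbk$ be a commutative ring and $n,r\ge 0$. Let $\Lambda(n,r)$ be the set of $n$-tuples of natural numbers (including $0$) with sum $r$. The degenerate affine Hecke algebra $AH_r$ is the $\Bbbk$-algebra generated by $x_1,\dots,x_r$ and $s_1,\dots,s_{r-1}$ such that the $x_i$ commute, the $s_i$ satisfy the Coxeter relations of the basic transpositions of the symmetric group $S_r$, and $$s_ix_i=x_{i+1}s_i+1,\qquad x_is_i=s_ix_{i+1}+1,\qquad x_is_j=s_jx_i\ \ (i\ne j,j+1).$$ Elements of $\Bbbk S_r$ and of $P_r=\Bbbk[x_1,\dots,x_r]$ are regarded as elements of $AH_r$ through the natural homomorphisms. For a composition $\nu$ of $r$ let $S_\nu\le S_r$ be the parabolic (Young) subgroup, let $P^\nu=P_r^{S_\nu}$ be the algebra of polynomials invariant under $S_\nu$ permuting the variables, and let $M(\nu)=\Bbbk_\nu\otimes_{\Bbbk S_\nu}\Bbbk S_r$ be the right permutation module induced from the trivial right $\Bbbk S_\nu$-module $\Bbbk_\nu$, with generator $m_\nu=1\otimes1$. Let $AS(n,r)=\operatorname{End}_{AH_r}\big(\bigoplus_{\nu\in\Lambda(n,r)}M(\nu)\otimes_{\Bbbk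 S_r}AH_r\big)$ (endomorphisms of right modules), and let $1_\nu\in AS(n,r)$ be the projection onto the summand indexed by $\nu$. For $\lambda,\mu\in\Lambda(n,r)$ let $\mathrm{Mat}_{\lambda,\mu}$ be the set of $n\times n$ matrices $A=(a_{i,j})$ of natural numbers with row sums $\lambda$ and column sums $\mu$. For such $A$ let $\lambda(A)$ (resp. $\mu(A)$) be the composition of $r$ obtained by reading the entries along rows from the top row (resp. down columns from the leftmost column). A composition of $r$ cuts $\{1,\dots,r\}$ into consecutive blocks, and $d_A\in S_r$ is the permutation that maps, for all $i,j$, the block of $\mu(A)$ coming from the entry $a_{i,j}$ onto the block of $\lambda(A)$ coming from the same entry, preserving order inside the block. Let $(S_{\mu(A)}\backslash S_\mu)_{\min}$ be the set of $y\in S_\mu$ of minimal length in the coset $S_{\mu(A)}y$. **Theorem 3.2.** Let $\lambda,\mu\in\Lambda(n,r)$. Taking components identifies the $\Bbbk$-module $1_\lambda AS(n,r)1_\mu$ with $$\operatorname{Hom}_{AH_r}\big(M(\mu)\otimes_{\Bbbk S_r}AH_r,\;M(\lambda)\otimes_{\Bbbk S_r}AH_r\big),$$ and this $\Bbbk$-module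 is free. For every $A\in\mathrm{Mat}_{\lambda,\mu}$ the $\Bbbk$-module $P^{\mu(A)}$ is free, and for every $f\in P^{\mu(A)}$ there is a unique right $AH_r$-module homomorphism $\xi_{A,f}:M(\mu)\otimes_{\Bbbk S_r}AH_r\to M(\lambda)\otimes_{\Bbbk S_r}AH_r$ such that $$\xi_{A,f}(m_\mu\otimes1)=\sum_{y\in(S_{\mu(A)}\backslash S_\mu)_{\min}}m_\lambda\otimes d_A\,f\,y .$$ Given any $\Bbbk$-basis $B_A$ of $P^{\mu(A)}$ for each $A\in\mathrm{Mat}_{\lambda,\mu}$, the elements $\xi_{A,f}$ with $A\in\mathrm{Mat}_{\lambda,\mu}$ and $f\in B_A$ form a $\Bbbk$-basis of this Hom module. -/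

import Mathlib

open scoped TensorProduct DirectSum
open MulOpposite

universe u v w

namespace DegAffSchur

/-! ## Compositions, Young subgroups, lengths -/

/-- `Λ(n,r)`: compositions of `r` with `n` parts (zero parts allowed). -/
abbrev Comp (n r : ℕ) : Type := {l : Fin n → ℕ // ∑ i, l i = r}

/-- For a composition `l` of `r`, cut `0 < 1 < ⋯ < r-1` into consecutive blocks of sizes
`l 0, l 1, …`: the `c`-th element of the `i`-th block is the position
`l 0 + ⋯ + l (i-1) + c`, see `Comp.cut_val`. -/
def Comp.cut {n r : ℕ} (l : Comp n r) : (Σ i : Fin n, Fin (l.1 i)) ≃ Fin r :=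
  finSigmaFinEquiv.trans (finCongr l.2)

theorem Comp.cut_val {n r : ℕ} (l : Comp n r) (p : Σ i : Fin n, Fin (l.1 i)) :
    (l.cut p : ℕ) = ∑ i : Fin p.1, l.1 (Fin.castLE p.1.2.le i) + p.2 := by
  simp [Comp.cut]

/-- The index of the block of `l` that contains a given position. -/
def Comp.block {n r : ℕ} (l : Comp n r) (p : Fin r) : Fin n := (l.cut.symm p).1

/-- The parabolic (Young) subgroup `S_l = S_{l 0} × S_{l 1} × ⋯` of `S_r`: the permutations
that preserve every block of `l`. -/
def Comp.young {n r : ℕ} (l : Comp n r) : Subgroup (Equiv.Perm (Fin r)) where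
  carrier := {g | ∀ p, l.block (g p) = l.block p}
  one_mem' := fun _ => rfl
  mul_mem' := fun {a b} ha hb p => (ha (b p)).trans (hb p)
  inv_mem' := fun {a} ha p => by
    have h := ha (a⁻¹ p)
    rw [← Equiv.Perm.mul_apply, mul_inv_cancel, Equiv.Perm.one_apply] at h
    exact h.symm

/-- The length of a permutation (its number of inversions). -/
def len {r : ℕ} (g : Equiv.Perm (Fin r)) : ℕ :=
  (Finset.univ.filter fun p : Fin r × Fin r => p.1 < p.2 ∧ g p.2 < g p.1).card

open Classical in
/-- `(K \ H)_min` for subgroups `K ≤ H` of `S_r`: the elements of `H` of minimal length in their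
coset `K y`. -/
noncomputable def minRight {r : ℕ} (K H : Subgroup (Equiv.Perm (Fin r))) :
    Finset (Equiv.Perm (Fin r)) :=
  Finset.univ.filter fun y => y ∈ H ∧ ∀ x ∈ K, len y ≤ len (x * y)

/-! ## Matrices with prescribed row and column sums -/

/-- The matrices over `ℕ` with row sums `lam` and column sums `mu`. -/
abbrev Mat {m n r : ℕ} (lam : Comp m r) (mu : Comp n r) : Type :=
  {A : Matrix (Fin m) (Fin n) ℕ // (∀ i, ∑ j, A i j = lam.1 i) ∧ ∀ j, ∑ i, A i j = mu.1 j}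

/-- The left redundancy `λ(A)`: the entries of `A` read along rows, starting with the top row. -/
def leftRed {m n r : ℕ} {lam : Comp m r} {mu : Comp n r} (A : Mat lam mu) : Comp (m * n) r :=
  ⟨fun t => A.1 (finProdFinEquiv.symm t).1 (finProdFinEquiv.symm t).2, by
    rw [Equiv.sum_comp finProdFinEquiv.symm (fun p : Fin m × Fin n => A.1 p.1 p.2),
      Fintype.sum_prod_type]
    simp only [A.2.1]
    exact lam.2⟩

/-- The right redundancy `μ(A)`: the entries of `A` read down columns, starting with the leftmost
column. -/
def rightRed {m n r : ℕ} {lam : Comp m r} {mu : Comp n r} (A : Mat lam mu) : Comp (n * m) r :=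
  ⟨fun t => A.1 (finProdFinEquiv.symm t).2 (finProdFinEquiv.symm t).1, by
    rw [Equiv.sum_comp finProdFinEquiv.symm (fun p : Fin n × Fin m => A.1 p.2 p.1),
      Fintype.sum_prod_type]
    simp only [A.2.2]
    exact mu.2⟩

/-- The bijection between the thin strings of the row `i`, column `j` propagating strings as they
occur below the crossings (in the blocks of `μ(A)`) and above the crossings (in the blocks of
`λ(A)`). -/
def strings {m n r : ℕ} {lam : Comp m r} {mu : Comp n r} (A : Mat lam mu) :
    (Σ t : Fin (n * m), Fin ((rightRed A).1 t)) ≃ (Σ t : Fin (m * n), Fin ((leftRed A).1 t)) :=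
  Equiv.sigmaCongr
    (finProdFinEquiv.symm.trans ((Equiv.prodComm (Fin n) (Fin m)).trans finProdFinEquiv))
    (fun t => finCongr (by
      simp only [rightRed, leftRed, Equiv.trans_apply, Equiv.symm_apply_apply]
      rfl))

/-- The permutation `d_A`: it maps the `c`-th position of the block of `μ(A)` belonging to the
entry in row `i`, column `j` to the `c`-th position of the block of `λ(A)` belonging to the same
entry.  This is the permutation obtained by expanding the strings of the double coset diagram of
`A` (read from bottom to top) into parallel thin strings. -/
def dPerm {m n r : ℕ} {lam : Comp m r} {mu : Comp n r} (A : Mat lam mu) : Equiv.Perm (Fin r) :=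
  (rightRed A).cut.symm.trans ((strings A).trans (leftRed A).cut)

/-! ## Invariant polynomials -/

/-- `P^l`: the polynomials in `x_0, …, x_{r-1}` invariant under the Young subgroup `S_l`, which
permutes the variables. -/
noncomputable def invariants (k : Type u) [CommRing k] {n r : ℕ} (l : Comp n r) :
    Subalgebra k (MvPolynomial (Fin r) k) where
  carrier := {f | ∀ g ∈ l.young, MvPolynomial.rename g f = f}
  mul_mem' := fun {a b} ha hb g hg => by rw [map_mul, ha g hg, hb g hg]
  add_mem' := fun {a b} ha hb g hg => by rw [map_add, ha g hg, hb g hg]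
  algebraMap_mem' := fun c g _ => AlgHom.commutes _ c

/-! ## The degenerate affine Hecke algebra -/

/-- Generators `x_0, …, x_{r-1}` and `s_0, …, s_{r-2}`; `s_i` corresponds to the transposition
`(i  i+1)`. -/
inductive Gen (r : ℕ) : Type
  | x (i : Fin r) : Gen r
  | s (i : ℕ) (h : i + 1 < r) : Gen r

/-- `x_i` in the free algebra. -/
def fx (k : Type u) [CommRing k] {r : ℕ} (i : Fin r) : FreeAlgebra k (Gen r) :=
  FreeAlgebra.ι k (Gen.x i)

/-- `s_i` in the free algebra. -/
def fs (k : Type u) [CommRing k] {r : ℕ} (i : ℕ) (h : i + 1 < r) : FreeAlgebra k (Gen r) :=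
  FreeAlgebra.ι k (Gen.s i h)

/-- The defining relations of the degenerate affine Hecke algebra. -/
inductive Rel (k : Type u) [CommRing k] (r : ℕ) :
    FreeAlgebra k (Gen r) → FreeAlgebra k (Gen r) → Prop
  | xx (i j : Fin r) : Rel k r (fx k i * fx k j) (fx k j * fx k i)
  | sq (i : ℕ) (h : i + 1 < r) : Rel k r (fs k i h * fs k i h) 1
  | braid (i : ℕ) (h : i + 1 < r) (h' : i + 1 + 1 < r) :
      Rel k r (fs k i h * fs k (i + 1) h' * fs k i h)
        (fs k (i + 1) h' * fs k i h * fs k (i + 1) h')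
  | comm (i j : ℕ) (hi : i + 1 < r) (hj : j + 1 < r) (hij : i + 1 < j) :
      Rel k r (fs k i hi * fs k j hj) (fs k j hj * fs k i hi)
  | sx (i : ℕ) (h : i + 1 < r) :
      Rel k r (fs k i h * fx k ⟨i, (Nat.lt_succ_self i).trans h⟩)
        (fx k ⟨i + 1, h⟩ * fs k i h + 1)
  | xs (i : ℕ) (h : i + 1 < r) :
      Rel k r (fx k ⟨i, (Nat.lt_succ_self i).trans h⟩ * fs k i h)
        (fs k i h * fx k ⟨i + 1, h⟩ + 1)
  | xs_comm (i : Fin r) (j : ℕ) (h : j + 1 < r) (h1 : i.1 ≠ j) (h2 : i.1 ≠ j + 1) :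
      Rel k r (fx k i * fs k j h) (fs k j h * fx k i)

/-- The degenerate affine Hecke algebra `AH_r` over `k`. -/
abbrev AH (k : Type u) [CommRing k] (r : ℕ) : Type u := RingQuot (Rel k r)

/-- The generator `x_i` of `AH_r`. -/
noncomputable def X (k : Type u) [CommRing k] {r : ℕ} (i : Fin r) : AH k r :=
  RingQuot.mkAlgHom k (Rel k r) (fx k i)

/-- The generator `s_i` of `AH_r`. -/
noncomputable def T (k : Type u) [CommRing k] {r : ℕ} (i : ℕ) (h : i + 1 < r) : AH k r :=
  RingQuot.mkAlgHom k (Rel k r) (fs k i h)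

theorem X_comm (k : Type u) [CommRing k] {r : ℕ} (i j : Fin r) :
    X k i * X k j = X k j * X k i := by
  have h := RingQuot.mkAlgHom_rel k (Rel.xx (k := k) i j)
  rwa [map_mul, map_mul] at h

/-! ### The symmetric group is presented by the Coxeter relations

This is needed to see that `s_i ↦ s_i` defines a homomorphism from `k S_r` to `AH_r`. -/

/-- The product `t_N t_{N-1} ⋯` with `d` factors. -/
def cycWord {M : Type v} [Monoid M] (t : ℕ → M) (N : ℕ) : ℕ → M
  | 0 => 1
  | d + 1 => cycWord t N d * t (N - d)

section Coxeter

variable {M : Type v} [Monoid M] {t : ℕ → M} {N : ℕ}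

theorem cycWord_comm
    (hc : ∀ i j, i + 1 < j → j < N + 1 → t i * t j = t j * t i) (i d : ℕ) (h : i + d < N) :
    cycWord t N d * t i = t i * cycWord t N d := by
  induction d with
  | zero => simp [cycWord]
  | succ d ih =>
    have e : t (N - d) * t i = t i * t (N - d) := (hc i (N - d) (by omega) (by omega)).symm
    simp only [cycWord]
    rw [mul_assoc, e, ← mul_assoc, ih (by omega), mul_assoc]

theorem cycWord_shift
    (hb : ∀ i, i + 1 < N + 1 → t i * t (i + 1) * t i = t (i + 1) * t i * t (i + 1))
    (hc : ∀ i j, i + 1 < j → j < N + 1 → t i * t j = t j * t i) (i d : ℕ)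
    (hd : d ≤ N + 1) (hi : i + 1 ≤ N) (h : N < i + d) :
    cycWord t N d * t (i + 1) = t i * cycWord t N d := by
  induction d with
  | zero => omega
  | succ d ih =>
    simp only [cycWord]
    by_cases h' : N < i + d
    · have e : t (N - d) * t (i + 1) = t (i + 1) * t (N - d) :=
        hc (N - d) (i + 1) (by omega) (by omega)
      rw [mul_assoc, e, ← mul_assoc, ih (by omega) h', mul_assoc]
    · cases d with
      | zero => omega
      | succ d =>
        have e1 : N - (d + 1) = i := by omega
        have e2 : N - d = i + 1 := by omega
        have c := cycWord_comm hc i d (by omega)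
        have b := hb i (by omega)
        simp only [cycWord, e1, e2]
        calc cycWord t N d * t (i + 1) * t i * t (i + 1)
            = cycWord t N d * (t (i + 1) * t i * t (i + 1)) := by simp only [mul_assoc]
          _ = cycWord t N d * t i * (t (i + 1) * t i) := by rw [← b]; simp only [mul_assoc]
          _ = t i * (cycWord t N d * t (i + 1) * t i) := by rw [c]; simp only [mul_assoc]

/-- A monoid generated by `N` elements satisfying the Coxeter relations of `S_{N+1}` has at most
`(N+1)!` elements. -/
theorem coxeter_card (t : ℕ → M) (N : ℕ) (hs : ∀ i, i < N → t i * t i = 1)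
    (hb : ∀ i, i + 1 < N → t i * t (i + 1) * t i = t (i + 1) * t i * t (i + 1))
    (hc : ∀ i j, i + 1 < j → j < N → t i * t j = t j * t i) :
    ∃ F : Finset M, F.card ≤ (N + 1).factorial ∧
      ∀ x ∈ Submonoid.closure (t '' {i | i < N}), x ∈ F := by
  classical
  induction N with
  | zero =>
    refine ⟨{1}, by simp, fun x hx => ?_⟩
    simpa using hx
  | succ N ih =>
    obtain ⟨F, hF, hF'⟩ := ih (fun i hi => hs i (by omega)) (fun i hi => hb i (by omega))
      (fun i j h1 h2 => hc i j h1 (by omega))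
    refine ⟨Finset.image₂ (· * ·) F ((Finset.range (N + 2)).image (cycWord t N)), ?_, ?_⟩
    · refine (Finset.card_image₂_le _ _ _).trans ?_
      have h2 : ((Finset.range (N + 2)).image (cycWord t N)).card ≤ N + 2 :=
        Finset.card_image_le.trans (by simp)
      calc _ ≤ (N + 1).factorial * (N + 2) := Nat.mul_le_mul hF h2
        _ = (N + 1 + 1).factorial := by rw [Nat.factorial_succ (N + 1), mul_comm]
    · intro x hx
      have key : ∃ h ∈ Submonoid.closure (t '' {i | i < N}), ∃ d, d ≤ N + 1 ∧
          x = h * cycWord t N d := by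
        induction hx using Submonoid.closure_induction_right with
        | one => exact ⟨1, one_mem _, 0, by omega, by simp [cycWord]⟩
        | mul_right x _ y hy ihx =>
          obtain ⟨h, hh, d, hd, rfl⟩ := ihx
          obtain ⟨i, hi, rfl⟩ := hy
          have hi : i < N + 1 := hi
          rcases lt_trichotomy (i + d) N with h1 | h1 | h1
          · refine ⟨h * t i, mul_mem hh (Submonoid.subset_closure ⟨i, ?_, rfl⟩), d, hd, ?_⟩
            · exact (by omega : i < N)
            · rw [mul_assoc, cycWord_comm hc i d h1, mul_assoc]
          · refine ⟨h, hh, d + 1, by omega, ?_⟩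
            have e : N - d = i := by omega
            simp only [cycWord, e, mul_assoc]
          · cases d with
            | zero => omega
            | succ d =>
              by_cases h2 : i + d = N
              · refine ⟨h, hh, d, by omega, ?_⟩
                have e : N - d = i := by omega
                simp only [cycWord, e, mul_assoc, hs i hi, mul_one]
              · obtain ⟨j, rfl⟩ : ∃ j, i = j + 1 := ⟨i - 1, by omega⟩
                refine ⟨h * t j, mul_mem hh (Submonoid.subset_closure ⟨j, ?_, rfl⟩), d + 1, hd, ?_⟩
                · exact (by omega : j < N)
                · rw [mul_assoc, cycWord_shift hb hc j (d + 1) hd (by omega) (by omega), mul_assoc]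
      obtain ⟨h, hh, d, hd, rfl⟩ := key
      exact Finset.mem_image₂_of_mem (hF' h hh)
        (Finset.mem_image_of_mem _ (Finset.mem_range.2 (by omega)))

end Coxeter

theorem swap_braid {α : Type v} [DecidableEq α] {a b c : α} (hab : a ≠ b) (hac : a ≠ c)
    (hbc : b ≠ c) : Equiv.swap a b * Equiv.swap b c * Equiv.swap a b =
      Equiv.swap b c * Equiv.swap a b * Equiv.swap b c := by
  rw [Equiv.swap_mul_swap_mul_swap hab hac, Equiv.swap_comm a b, Equiv.swap_comm b c,
    Equiv.swap_mul_swap_mul_swap hbc.symm hac.symm]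
  exact Equiv.swap_comm _ _

/-- Elements of a monoid that satisfy the Coxeter relations of the basic transpositions of `S_r`
define a homomorphism from `S_r`. -/
theorem exists_perm_hom {M : Type v} [Monoid M] (r : ℕ) (t : (i : ℕ) → i + 1 < r → M)
    (hs : ∀ i h, t i h * t i h = 1)
    (hb : ∀ i h h', t i h * t (i + 1) h' * t i h = t (i + 1) h' * t i h * t (i + 1) h')
    (hc : ∀ i j hi hj, i + 1 < j → t i hi * t j hj = t j hj * t i hi) :
    ∃ f : Equiv.Perm (Fin r) →* M, ∀ i h,
      f (Equiv.swap ⟨i, (Nat.lt_succ_self i).trans h⟩ ⟨i + 1, h⟩) = t i h := by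
  classical
  cases r with
  | zero => exact ⟨1, fun i h => absurd h (by omega)⟩
  | succ N =>
    let p : ℕ → Equiv.Perm (Fin (N + 1)) := fun i =>
      if h : i + 1 < N + 1 then Equiv.swap ⟨i, (Nat.lt_succ_self i).trans h⟩ ⟨i + 1, h⟩ else 1
    let q : ℕ → M := fun i => if h : i + 1 < N + 1 then t i h else 1
    have hp : ∀ i (h : i + 1 < N + 1),
        p i = Equiv.swap ⟨i, (Nat.lt_succ_self i).trans h⟩ ⟨i + 1, h⟩ := fun i h => dif_pos h
    have hq : ∀ i (h : i + 1 < N + 1), q i = t i h := fun i h => dif_pos h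
    let u : ℕ → Equiv.Perm (Fin (N + 1)) × M := fun i => (p i, q i)
    obtain ⟨F, hF, hF'⟩ := coxeter_card u N
      (fun i hi => by
        have h : i + 1 < N + 1 := by omega
        refine Prod.ext ?_ ?_
        · simp only [u, Prod.fst_mul, Prod.fst_one, hp i h, Equiv.swap_mul_self]
        · simp only [u, Prod.snd_mul, Prod.snd_one, hq i h, hs])
      (fun i hi => by
        have h : i + 1 < N + 1 := by omega
        have h' : i + 1 + 1 < N + 1 := by omega
        refine Prod.ext ?_ ?_
        · simp only [u, Prod.fst_mul, hp i h, hp (i + 1) h']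
          have ne1 : (⟨i, (Nat.lt_succ_self i).trans h⟩ : Fin (N + 1)) ≠ ⟨i + 1, h⟩ := by simp
          have ne2 : (⟨i, (Nat.lt_succ_self i).trans h⟩ : Fin (N + 1)) ≠ ⟨i + 1 + 1, h'⟩ := by
            simp only [ne_eq, Fin.mk.injEq]; omega
          have ne3 : (⟨i + 1, h⟩ : Fin (N + 1)) ≠ ⟨i + 1 + 1, h'⟩ := by simp
          exact swap_braid ne1 ne2 ne3
        · simp only [u, Prod.snd_mul, hq i h, hq (i + 1) h', hb])
      (fun i j hij hj => by
        have h : i + 1 < N + 1 := by omega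
        have h' : j + 1 < N + 1 := by omega
        refine Prod.ext ?_ ?_
        · simp only [u, Prod.fst_mul, hp i h, hp j h']
          refine (Equiv.Perm.Disjoint.commute ?_).eq
          rw [Equiv.Perm.disjoint_iff_disjoint_support, Equiv.Perm.support_swap (by simp),
            Equiv.Perm.support_swap (by simp)]
          simp only [Finset.disjoint_left, Finset.mem_insert, Finset.mem_singleton, Fin.ext_iff]
          intro a ha
          omega
        · simp only [u, Prod.snd_mul, hq i h, hq j h', hc i j h h' hij])
    let W := Submonoid.closure (u '' {i | i < N})
    let π : W →* Equiv.Perm (Fin (N + 1)) := (MonoidHom.fst _ _).comp W.subtype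
    have hu : ∀ i, i < N → u i ∈ W := fun i hi => Submonoid.subset_closure ⟨i, hi, rfl⟩
    have hsurj : Function.Surjective π := by
      rw [← MonoidHom.mrange_eq_top, ← top_le_iff, ← Equiv.Perm.mclosure_swap_castSucc_succ,
        Submonoid.closure_le]
      rintro _ ⟨i, rfl⟩
      refine ⟨⟨u i, hu i i.2⟩, ?_⟩
      exact hp i (by omega)
    have : Finite W := (F.finite_toSet.subset fun x hx => hF' x hx).to_subtype
    have : Fintype W := Fintype.ofFinite W
    have hcard : Fintype.card W ≤ Fintype.card (Equiv.Perm (Fin (N + 1))) := by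
      rw [Fintype.card_perm, Fintype.card_fin]
      refine le_trans ?_ hF
      rw [← Fintype.card_coe]
      exact Fintype.card_le_of_injective (fun x : W => (⟨x.1, hF' x.1 x.2⟩ : F))
        (fun a b hab => Subtype.ext (congrArg (fun z : F => z.1) hab))
    have hbij : Function.Bijective π :=
      (Fintype.bijective_iff_surjective_and_card π).2
        ⟨hsurj, le_antisymm hcard (Fintype.card_le_of_surjective π hsurj)⟩
    let e : W ≃* Equiv.Perm (Fin (N + 1)) := MulEquiv.ofBijective π hbij
    refine ⟨((MonoidHom.snd _ _).comp W.subtype).comp e.symm.toMonoidHom, fun i h => ?_⟩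
    have hi : i < N := by omega
    have he : e ⟨u i, hu i hi⟩ = Equiv.swap ⟨i, (Nat.lt_succ_self i).trans h⟩ ⟨i + 1, h⟩ := hp i h
    rw [← he]
    change (e.symm (e ⟨u i, hu i hi⟩)).1.2 = t i h
    rw [MulEquiv.symm_apply_apply]
    exact hq i h

theorem exists_permToAH (k : Type u) [CommRing k] (r : ℕ) :
    ∃ f : Equiv.Perm (Fin r) →* AH k r, ∀ i h,
      f (Equiv.swap ⟨i, (Nat.lt_succ_self i).trans h⟩ ⟨i + 1, h⟩) = T k i h := by
  refine exists_perm_hom r (fun i h => T k i h) ?_ ?_ ?_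
  · intro i h
    have e := RingQuot.mkAlgHom_rel k (Rel.sq (k := k) i h)
    rwa [map_mul, map_one] at e
  · intro i h h'
    have e := RingQuot.mkAlgHom_rel k (Rel.braid (k := k) i h h')
    simp only [map_mul] at e
    exact e
  · intro i j hi hj hij
    have e := RingQuot.mkAlgHom_rel k (Rel.comm (k := k) i j hi hj hij)
    simp only [map_mul] at e
    exact e

/-- The homomorphism from `S_r` to (the multiplicative monoid of) `AH_r` that maps the basic
transposition `(i  i+1)` to the generator `s_i`; it is determined by `permToAH_swap`. -/
noncomputable def permToAH (k : Type u) [CommRing k] (r : ℕ) : Equiv.Perm (Fin r) →* AH k r :=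
  (exists_permToAH k r).choose

theorem permToAH_swap (k : Type u) [CommRing k] (r : ℕ) (i : ℕ) (h : i + 1 < r) :
    permToAH k r (Equiv.swap ⟨i, (Nat.lt_succ_self i).trans h⟩ ⟨i + 1, h⟩) = T k i h :=
  (exists_permToAH k r).choose_spec i h

/-- The homomorphism from the group algebra `k S_r` to `AH_r`. -/
noncomputable def groupToAH (k : Type u) [CommRing k] (r : ℕ) :
    MonoidAlgebra k (Equiv.Perm (Fin r)) →ₐ[k] AH k r :=
  MonoidAlgebra.lift k _ _ (permToAH k r)

/-- The `X_i` commute, so they generate a commutative subalgebra of `AH_r`. -/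
theorem adjoin_X_comm (k : Type u) [CommRing k] (r : ℕ) :
    IsMulCommutative (Algebra.adjoin k (Set.range (X k : Fin r → AH k r))) :=
  Algebra.isMulCommutative_adjoin k (by
    rintro _ ⟨i, rfl⟩ _ ⟨j, rfl⟩
    exact X_comm k i j)

open scoped IsMulCommutative in
/-- The homomorphism from the polynomial algebra `P_r = k[x_0, …, x_{r-1}]` to `AH_r` that maps
`x_i` to the generator `x_i`, see `polyToAH_X`. -/
noncomputable def polyToAH (k : Type u) [CommRing k] (r : ℕ) :
    MvPolynomial (Fin r) k →ₐ[k] AH k r :=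
  have := adjoin_X_comm k r
  (Algebra.adjoin k (Set.range (X k : Fin r → AH k r))).val.comp
    (MvPolynomial.aeval fun i => ⟨X k i, Algebra.subset_adjoin ⟨i, rfl⟩⟩)

open scoped IsMulCommutative in
theorem polyToAH_X (k : Type u) [CommRing k] (r : ℕ) (i : Fin r) :
    polyToAH k r (MvPolynomial.X i) = X k i := by
  have := adjoin_X_comm k r
  simp [polyToAH]

/-! ## Induced right modules

A right module over a ring `R` is a module over `Rᵐᵒᵖ`: `op a • m` is `m a`. -/

section Ind

variable {k : Type u} [CommRing k] {R : Type v} [Ring R] [Algebra k R] {S : Type w} [Ring S]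
  [Algebra k S] (φ : R →ₐ[k] S) (M : Type v) [AddCommGroup M] [Module k M] [Module Rᵐᵒᵖ M]

/-- The `S`-submodule of `M ⊗_k S` generated by the elements `m a ⊗ b - m ⊗ φ(a) b`.
The factors of the tensor product over `k` are written in the opposite order, `b ⊗ₜ m` for
`m ⊗ b`, since Mathlib lets scalars act on the left-hand factor; the right action of `S` is by
right multiplication on the factor `S`. -/
def balance : Submodule Sᵐᵒᵖ (S ⊗[k] M) :=
  Submodule.span Sᵐᵒᵖ {z | ∃ (m : M) (a : R) (b : S),
    z = b ⊗ₜ[k] (op a • m) - (φ a * b) ⊗ₜ[k] m}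

/-- The induced right `S`-module `M ⊗_R S`, for a right `R`-module `M` and an algebra homomorphism
`φ : R → S`: the quotient of `M ⊗_k S` that makes the tensor product balanced over `R`. -/
def Ind : Type _ := (S ⊗[k] M) ⧸ balance φ M

noncomputable instance : AddCommGroup (Ind φ M) :=
  inferInstanceAs (AddCommGroup ((S ⊗[k] M) ⧸ balance φ M))

noncomputable instance : Module Sᵐᵒᵖ (Ind φ M) :=
  inferInstanceAs (Module Sᵐᵒᵖ ((S ⊗[k] M) ⧸ balance φ M))

noncomputable instance : Module k (Ind φ M) :=
  inferInstanceAs (Module k ((S ⊗[k] M) ⧸ balance φ M))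

instance : SMulCommClass Sᵐᵒᵖ k (Ind φ M) :=
  inferInstanceAs (SMulCommClass Sᵐᵒᵖ k ((S ⊗[k] M) ⧸ balance φ M))

instance : IsScalarTower k Sᵐᵒᵖ (Ind φ M) :=
  inferInstanceAs (IsScalarTower k Sᵐᵒᵖ ((S ⊗[k] M) ⧸ balance φ M))

/-- The element `m ⊗ b` of `M ⊗_R S`. -/
def Ind.tmul {M : Type v} [AddCommGroup M] [Module k M] [Module Rᵐᵒᵖ M] (m : M) (b : S) :
    Ind φ M :=
  Submodule.Quotient.mk (p := balance φ M) (b ⊗ₜ[k] m)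

end Ind

/-- The trivial right module `k` of the group algebra `k G`: every `g ∈ G` acts as the identity. -/
def Triv (k : Type u) (_G : Type v) : Type u := k

section Triv

variable (k : Type u) [CommRing k] (G : Type v) [Group G]

instance : AddCommGroup (Triv k G) := inferInstanceAs (AddCommGroup k)

instance : Module k (Triv k G) := inferInstanceAs (Module k k)

noncomputable instance : Module (MonoidAlgebra k G)ᵐᵒᵖ (Triv k G) :=
  Module.compHom k
    ((MonoidAlgebra.lift k k G (1 : G →* k)).toRingHom.fromOpposite fun _ _ => Commute.all _ _)

/-- The element `1` of the trivial module `k`. -/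
def Triv.one : Triv k G := (1 : k)

end Triv

section Modules

variable (k : Type u) [CommRing k] {n r : ℕ} (l : Comp n r)

/-- The inclusion `k S_l → k S_r`. -/
noncomputable def youngIncl :
    MonoidAlgebra k l.young →ₐ[k] MonoidAlgebra k (Equiv.Perm (Fin r)) :=
  MonoidAlgebra.mapDomainAlgHom k k l.young.subtype

/-- The permutation module `M(l) = k_l ⊗_{k S_l} k S_r`, a right `k S_r`-module. -/
abbrev PermMod : Type u := Ind (youngIncl k l) (Triv k l.young)

/-- The generator `m_l = 1 ⊗ 1` of `M(l)`. -/
noncomputable def permGen : PermMod k l :=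
  Ind.tmul (youngIncl k l) (Triv.one k l.young) 1

/-- The induced module `M(l) ⊗_{k S_r} AH_r`, a right `AH_r`-module. -/
abbrev AffMod : Type u := Ind (groupToAH k r) (PermMod k l)

/-- The element `m_l ⊗ a` of `M(l) ⊗_{k S_r} AH_r`. -/
noncomputable def affElt (a : AH k r) : AffMod k l :=
  Ind.tmul (groupToAH k r) (permGen k l) a

/-- `Hom_{AH_r}(M(mu) ⊗ AH_r, M(lam) ⊗ AH_r)`, homomorphisms of right `AH_r`-modules. -/
abbrev AffHom (mu lam : Comp n r) : Type u := AffMod k mu →ₗ[(AH k r)ᵐᵒᵖ] AffMod k lam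

variable {k}

/-- The vector `∑ m_lam ⊗ d_A f y`, the sum over `y ∈ (S_{μ(A)} \ S_mu)_min`. -/
noncomputable def xiVec {lam mu : Comp n r} (A : Mat lam mu) (f : MvPolynomial (Fin r) k) :
    AffMod k lam :=
  ∑ y ∈ minRight (rightRed A).young mu.young,
    affElt k lam (permToAH k r (dPerm A) * polyToAH k r f * permToAH k r y)

end Modules

/-! ## The degenerate affine Schur algebra -/

section Schur

variable (k : Type u) [CommRing k] (n r : ℕ)

/-- The degenerate affine Schur algebra `AS(n,r)`: the endomorphism algebra of the right
`AH_r`-module `⨁ M(l) ⊗_{k S_r} AH_r`, the sum over `l ∈ Λ(n,r)`. -/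
abbrev AS : Type u := Module.End (AH k r)ᵐᵒᵖ (⨁ l : Comp n r, AffMod k l)

variable {n r}

/-- The idempotent `1_l` of `AS(n,r)`: the projection onto the summand `M(l) ⊗ AH_r`. -/
noncomputable def idem (l : Comp n r) : AS k n r :=
  DirectSum.lof (AH k r)ᵐᵒᵖ (Comp n r) (fun l => AffMod k l) l ∘ₗ
    DirectSum.component (AH k r)ᵐᵒᵖ (Comp n r) (fun l => AffMod k l) l

/-- The `k`-submodule `1_lam AS(n,r) 1_mu` of `AS(n,r)`. -/
noncomputable def corner (lam mu : Comp n r) : Submodule k (AS k n r) :=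
  LinearMap.range (LinearMap.mulLeft k (idem k lam) ∘ₗ LinearMap.mulRight k (idem k mu))

/-- The `k`-linear map that sends an endomorphism of the direct sum to its component
`M(mu) ⊗ AH_r → M(lam) ⊗ AH_r`. -/
noncomputable def compMap (lam mu : Comp n r) : AS k n r →ₗ[k] AffHom k mu lam where
  toFun a := DirectSum.component (AH k r)ᵐᵒᵖ (Comp n r) (fun l => AffMod k l) lam ∘ₗ a ∘ₗ
    DirectSum.lof (AH k r)ᵐᵒᵖ (Comp n r) (fun l => AffMod k l) mu
  map_add' _ _ := by
    ext
    simp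
  map_smul' _ _ := by
    ext
    rfl

end Schur

end DegAffSchur

/-!
The statement is a Mackey decomposition for `AH_r`, obtained by passing to the leading terms with
respect to the degree in the variables `x_i`.

A homomorphism from `M(μ) ⊗ AH_r` is determined by the image of `m_μ ⊗ 1`, and the possible images
are the vectors fixed by `S_μ` (`exists_affHom`, `affHom_ext`).  So the task is to find the
`S_μ`-invariants of `M(λ) ⊗ AH_r`.

This module is spanned by the `m_λ ⊗ g f` with `g ∈ S_r` and `f ∈ P_r`, and `g` matters only
through its coset `S_λ g`, that is, through the word obtained by composing `g` with the map that
sends a position to its block of `λ`.  To see that there are no further relations, `AH_r` is made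
to act from the right on all functions from words to `P_r` (`wordRep`): `x_j` acts by
multiplication, and `s_i` by permuting the letters of the words and the variables, plus the divided
difference `∂_i`.  The operators of the `s_i` satisfy the Coxeter relations because both sides of
each relation agree on constant functions and commute with the variables in the same way
(`wordFun_hom_ext`).  The resulting map `toWord` is injective (`toWord_injective`), which is the
part of the PBW theorem for `AH_r` that is needed.

Up to terms of lower degree, `S_r` acts on word functions by permutations
(`wordRep_perm_sub_mem_lowDeg`), so the leading term of an invariant vector is a family of
polynomials on words, equivariant under `S_μ`.  The `S_μ`-orbits of words of content `λ` correspond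
to the matrices `A`: the word of `d_A` represents its orbit and has the stabilizer `S_{μ(A)}`
(`exists_matWord`, `mat_eq_of_matWord`, `mem_young_rightRed`).  Hence such a family amounts to one
element of `P^{μ(A)}` for each `A`.  Conversely, `f ∈ P^{μ(A)}` commutes with `S_{μ(A)}`
(`invariants_commute`), which makes `∑_y m_λ ⊗ d_A f y` invariant, and its leading term is the
family given by `f`.  Induction on the degree shows that `(f_A) ↦ ∑_A ∑_y m_λ ⊗ d_A f_A y` is a
bijection from `∏_A P^{μ(A)}` onto the invariants (`xiSum_injective`, `mem_range_xiSum`).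

The invariants `P^{μ(A)}` are free on the orbit sums of monomials (`free_invariants`).
-/

namespace DegAffSchur

/-! ### Blocks of a composition -/

theorem Comp.block_monotone {n r : ℕ} (l : Comp n r) : Monotone l.block := by
  intro p q hpq
  by_contra! hlt
  let L : ℕ → ℕ := fun i => if h : i < n then l.1 ⟨i, h⟩ else 0
  have key : ∀ a : Fin n, ∑ i : Fin a, l.1 (Fin.castLE a.2.le i) = ∑ i ∈ Finset.range a, L i := by
    intro a
    rw [← Fin.sum_univ_eq_sum_range]
    refine Finset.sum_congr rfl fun i _ => ?_
    simp [L, i.2.trans a.2, Fin.castLE]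
  have hp := l.cut_val (l.cut.symm p)
  have hq := l.cut_val (l.cut.symm q)
  rw [Equiv.apply_symm_apply, key] at hp hq
  have h1 := (l.cut.symm q).2.2
  have h2 : L (l.cut.symm q).1 = l.1 (l.cut.symm q).1 := by simp [L]
  have h3 := Finset.sum_le_sum_of_subset (f := L)
    (Finset.range_subset_range.2 (Nat.succ_le_of_lt (Fin.lt_def.1 hlt)))
  simp only [Comp.block, Nat.succ_eq_add_one, Finset.sum_range_succ] at h3
  have : (p : ℕ) ≤ q := hpq
  omega

theorem Comp.block_cut {n r : ℕ} (l : Comp n r) (s : Σ i : Fin n, Fin (l.1 i)) :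
    l.block (l.cut s) = s.1 := by
  simp [Comp.block]

theorem Comp.card_block {n r : ℕ} (l : Comp n r) (i : Fin n) :
    Fintype.card {p // l.block p = i} = l.1 i := by
  rw [← Fintype.card_fin (l.1 i)]
  exact Fintype.card_congr ((l.cut.symm.subtypeEquiv (q := fun s => s.1 = i) fun p => Iff.rfl).trans
    (Equiv.sigmaSubtype i))

/-- A monotone labelling of the positions is determined by the sizes of its fibres. -/
theorem monotone_eq_of_card_fiber {r : ℕ} {α : Type*} [PartialOrder α] [DecidableEq α]
    {f g : Fin r → α}
    (hf : Monotone f) (hg : Monotone g)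
    (h : ∀ a, Fintype.card {p // f p = a} = Fintype.card {p // g p = a}) : f = g := by
  let e : Fin r ≃ Fin r := Equiv.ofFiberEquiv fun a => Fintype.equivOfCardEq (h a)
  have he : g ∘ e = f := funext fun p => Equiv.ofFiberEquiv_map _ p
  have := Tuple.unique_monotone (f := g) (σ := e) (τ := Equiv.refl _) (by rwa [he]) hg
  rw [he] at this
  exact this

/-- Two labellings whose fibres have the same sizes differ by a permutation of the positions. -/
theorem exists_perm_comp_eq {r : ℕ} {α : Type*} [DecidableEq α] {f g : Fin r → α}
    (h : ∀ a, Fintype.card {p // f p = a} = Fintype.card {p // g p = a}) :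
    ∃ e : Equiv.Perm (Fin r), ∀ p, g (e p) = f p :=
  ⟨Equiv.ofFiberEquiv fun a => Fintype.equivOfCardEq (h a), Equiv.ofFiberEquiv_map _⟩

section Mat

variable {m n r : ℕ} {lam : Comp m r} {mu : Comp n r} (A : Mat lam mu)

theorem card_fst_block {a b r : ℕ} (l : Comp (a * b) r) (i : Fin a) :
    Fintype.card {p // (finProdFinEquiv.symm (l.block p)).1 = i} =
      ∑ j, l.1 (finProdFinEquiv (i, j)) := by
  simp only [← l.card_block, Fintype.card_subtype]
  rw [← Finset.card_biUnion]
  · congr 1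
    ext p
    simp [Prod.ext_iff, ← Equiv.symm_apply_eq]
  · intro j _ j' _ hjj
    simp only [Finset.disjoint_left, Finset.mem_filter, Finset.mem_univ, true_and]
    intro p hp hp'
    rw [hp] at hp'
    simp at hp'
    exact hjj hp'

theorem fst_finProdFinEquiv_symm_monotone {a b : ℕ} :
    Monotone fun t : Fin (a * b) => (finProdFinEquiv.symm t).1 := by
  intro s t hst
  simp only [finProdFinEquiv_symm_apply, Fin.le_def, Fin.coe_divNat]
  exact Nat.div_le_div_right hst

/-- The blocks of `μ(A)` coming from the column `j` fill the `j`-th block of `μ`. -/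
theorem fst_rightRed_block (p : Fin r) :
    (finProdFinEquiv.symm ((rightRed A).block p)).1 = mu.block p := by
  refine congrFun (monotone_eq_of_card_fiber
    (f := fun p => (finProdFinEquiv.symm ((rightRed A).block p)).1)
    (fst_finProdFinEquiv_symm_monotone.comp (rightRed A).block_monotone) mu.block_monotone
    fun j => ?_) p
  rw [card_fst_block, mu.card_block, ← A.2.2 j]
  simp [rightRed, -finProdFinEquiv_symm_apply]

theorem fst_leftRed_block (p : Fin r) :
    (finProdFinEquiv.symm ((leftRed A).block p)).1 = lam.block p := by
  refine congrFun (monotone_eq_of_card_fiber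
    (f := fun p => (finProdFinEquiv.symm ((leftRed A).block p)).1)
    (fst_finProdFinEquiv_symm_monotone.comp (leftRed A).block_monotone) lam.block_monotone
    fun j => ?_) p
  rw [card_fst_block, lam.card_block, ← A.2.1 j]
  simp [leftRed, -finProdFinEquiv_symm_apply]

/-- The word of `A`, with the block of `λ` that contains `d_A p` as its letter at `p`; it encodes
the coset `S_λ d_A`. -/
def matWord (p : Fin r) : Fin m := lam.block (dPerm A p)

theorem leftRed_block_dPerm (p : Fin r) : (leftRed A).block (dPerm A p) =
    finProdFinEquiv (finProdFinEquiv.symm ((rightRed A).block p)).swap := by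
  rw [dPerm, Equiv.trans_apply, Equiv.trans_apply, Comp.block_cut]
  rfl

theorem snd_rightRed_block (p : Fin r) :
    (finProdFinEquiv.symm ((rightRed A).block p)).2 = matWord A p := by
  rw [matWord, ← fst_leftRed_block A, leftRed_block_dPerm, Equiv.symm_apply_apply, Prod.fst_swap]

theorem rightRed_block (p : Fin r) :
    (rightRed A).block p = finProdFinEquiv (mu.block p, matWord A p) := by
  rw [← fst_rightRed_block A, ← snd_rightRed_block A, Prod.mk.eta, Equiv.apply_symm_apply]

/-- `S_{μ(A)}` is the stabilizer in `S_μ` of the word of `A`. -/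
theorem mem_young_rightRed {g : Equiv.Perm (Fin r)} :
    g ∈ (rightRed A).young ↔ g ∈ mu.young ∧ ∀ p, matWord A (g p) = matWord A p := by
  change (∀ p, (rightRed A).block (g p) = (rightRed A).block p) ↔
    (∀ p, mu.block (g p) = mu.block p) ∧ _
  simp only [rightRed_block, EmbeddingLike.apply_eq_iff_eq, Prod.mk.injEq, forall_and]

theorem young_rightRed_le : (rightRed A).young ≤ mu.young :=
  fun _ hg => ((mem_young_rightRed A).1 hg).1

theorem card_block_matWord (j : Fin n) (i : Fin m) :
    Fintype.card {p // (mu.block p, matWord A p) = (j, i)} = A.1 i j := by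
  have := (rightRed A).card_block (finProdFinEquiv (j, i))
  simp only [rightRed_block, EmbeddingLike.apply_eq_iff_eq] at this
  rw [this]
  simp [rightRed, -finProdFinEquiv_symm_apply]

/-- Every word of content `λ` lies in the `S_μ`-orbit of the word of some matrix. -/
theorem exists_matWord (g : Equiv.Perm (Fin r)) :
    ∃ (A : Mat lam mu) (y : Equiv.Perm (Fin r)), y ∈ mu.young ∧
      ∀ p, matWord A (y p) = lam.block (g p) := by
  have h1 : ∀ i, ∑ j, Fintype.card {p // (mu.block p, lam.block (g p)) = (j, i)} = lam.1 i := by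
    intro i
    rw [← lam.card_block, Fintype.card_congr (g.subtypeEquiv (p := fun p => lam.block (g p) = i)
      (q := fun p => lam.block p = i) fun _ => Iff.rfl).symm]
    simp only [Fintype.card_subtype]
    rw [← Finset.card_biUnion]
    · congr 1
      ext p
      simp
    · intro j _ j' _ hjj
      simp only [Finset.disjoint_left, Finset.mem_filter, Finset.mem_univ, true_and]
      intro p hp hp'
      simp_all
  have h2 : ∀ j, ∑ i, Fintype.card {p // (mu.block p, lam.block (g p)) = (j, i)} = mu.1 j := by
    intro i
    rw [← mu.card_block]
    simp only [Fintype.card_subtype]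
    rw [← Finset.card_biUnion]
    · congr 1
      ext p
      simp
    · intro j _ j' _ hjj
      simp only [Finset.disjoint_left, Finset.mem_filter, Finset.mem_univ, true_and]
      intro p hp hp'
      simp_all
  let A : Mat lam mu := ⟨fun i j => _, h1, h2⟩
  obtain ⟨y, hy⟩ := exists_perm_comp_eq (f := fun p => (mu.block p, lam.block (g p)))
    (g := fun p => (mu.block p, matWord A p))
    (fun a => (card_block_matWord A a.1 a.2).symm)
  exact ⟨A, y, fun p => (Prod.ext_iff.1 (hy p)).1, fun p => (Prod.ext_iff.1 (hy p)).2⟩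

/-- The words of different matrices lie in different `S_μ`-orbits. -/
theorem mat_eq_of_matWord {A B : Mat lam mu} {y : Equiv.Perm (Fin r)} (hy : y ∈ mu.young)
    (h : ∀ p, matWord A (y p) = matWord B p) : A = B := by
  ext i j
  rw [← card_block_matWord A j i, ← card_block_matWord B j i]
  refine (Fintype.card_congr (y.subtypeEquiv fun p => ?_)).symm
  rw [h, hy p]

instance : Finite (Mat lam mu) := by
  refine Finite.of_injective
    (fun A : Mat lam mu => fun (i : Fin m) (j : Fin n) =>
      (⟨A.1 i j, Nat.lt_succ_of_le ((Finset.single_le_sum (f := fun j => A.1 i j)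
        (fun _ _ => Nat.zero_le _) (Finset.mem_univ j)).trans (A.2.1 i).le)⟩ :
          Fin (lam.1 i + 1))) ?_
  intro A B h
  ext i j
  exact congrArg Fin.val (congrFun (congrFun h i) j)

end Mat

/-! ### Lengths and minimal coset representatives -/

/-- The transposition `(i  i+1)`. -/
abbrev adjSwap {r : ℕ} (i : ℕ) (h : i + 1 < r) : Equiv.Perm (Fin r) :=
  Equiv.swap ⟨i, (Nat.lt_succ_self i).trans h⟩ ⟨i + 1, h⟩

theorem adjSwap_mem_young {n r : ℕ} (l : Comp n r) (i : ℕ) (h : i + 1 < r)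
    (hi : l.block ⟨i, (Nat.lt_succ_self i).trans h⟩ = l.block ⟨i + 1, h⟩) :
    adjSwap i h ∈ l.young := by
  intro p
  by_cases h1 : p = ⟨i, (Nat.lt_succ_self i).trans h⟩
  · rw [h1, Equiv.swap_apply_left, hi]
  by_cases h2 : p = ⟨i + 1, h⟩
  · rw [h2, Equiv.swap_apply_right, hi]
  · rw [Equiv.swap_apply_of_ne_of_ne h1 h2]

/-- Exchanging the values `i` and `i + 1` of `y`, where they occur in the wrong order, removes one
inversion. -/
theorem len_adjSwap_mul_lt {r : ℕ} (y : Equiv.Perm (Fin r)) (i : ℕ) (h : i + 1 < r)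
    (hy : y⁻¹ ⟨i + 1, h⟩ < y⁻¹ ⟨i, (Nat.lt_succ_self i).trans h⟩) :
    len (adjSwap i h * y) < len y := by
  refine Finset.card_lt_card (Finset.ssubset_iff_of_subset ?_ |>.2
    ⟨(y⁻¹ ⟨i + 1, h⟩, y⁻¹ ⟨i, (Nat.lt_succ_self i).trans h⟩), ?_, ?_⟩)
  · rintro ⟨a, b⟩ hab
    rw [Finset.mem_filter_univ, Equiv.Perm.mul_apply, Equiv.Perm.mul_apply] at hab
    rw [Finset.mem_filter_univ]
    dsimp only at hab ⊢
    refine ⟨hab.1, ?_⟩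
    have hne : y a ≠ y b := fun e => hab.1.ne (y.injective e)
    have ha : y a = ⟨i, (Nat.lt_succ_self i).trans h⟩ → y b ≠ ⟨i + 1, h⟩ := by
      intro e1 e2
      rw [← e1, ← e2, Equiv.Perm.coe_inv, Equiv.symm_apply_apply, Equiv.symm_apply_apply] at hy
      exact absurd hab.1 hy.not_gt
    have h2 := hab.2
    simp only [Equiv.swap_apply_def, Fin.ext_iff, Fin.lt_def, ne_eq] at h2 hne ha ⊢
    split_ifs at h2 <;> simp at h2 <;> omega
  · simpa using hy
  · rw [Finset.mem_filter_univ]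
    simp

/-- A permutation without descents at the values `i`, `i + 1` in a common block is increasing on
the preimages of the blocks. -/
theorem inv_strictMonoOn_block {n r : ℕ} (l : Comp n r) (y : Equiv.Perm (Fin r))
    (hy : ∀ i (h : i + 1 < r),
      l.block ⟨i, (Nat.lt_succ_self i).trans h⟩ = l.block ⟨i + 1, h⟩ →
        y⁻¹ ⟨i, (Nat.lt_succ_self i).trans h⟩ < y⁻¹ ⟨i + 1, h⟩)
    (p q : Fin r) (hpq : p < q) (hb : l.block p = l.block q) : y⁻¹ p < y⁻¹ q := by
  obtain ⟨p, hp⟩ := p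
  obtain ⟨q, hq⟩ := q
  have hpq : p < q := hpq
  induction q, hpq using Nat.le_induction with
  | base => exact hy p hq hb
  | succ q hpq ih =>
    have h1 : l.block ⟨p, hp⟩ ≤ l.block ⟨q, by omega⟩ :=
      l.block_monotone (Fin.mk_le_mk.2 (by omega))
    have h2 : l.block ⟨q, by omega⟩ ≤ l.block ⟨q + 1, hq⟩ :=
      l.block_monotone (Fin.mk_le_mk.2 (by omega))
    exact (ih (by omega) (Fin.mk_lt_mk.2 (by omega)) (le_antisymm h1 (h2.trans hb.ge))).trans
      (hy q hq (le_antisymm h2 (hb.ge.trans h1)))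

/-- Two elements of a coset `S_l y` whose inverses are increasing on the blocks coincide. -/
theorem eq_one_of_inv_strictMonoOn_block {n r : ℕ} (l : Comp n r) (x y : Equiv.Perm (Fin r))
    (hx : x ∈ l.young)
    (hy : ∀ p q : Fin r, p < q → l.block p = l.block q → y⁻¹ p < y⁻¹ q)
    (hxy : ∀ p q : Fin r, p < q → l.block p = l.block q → (x * y)⁻¹ p < (x * y)⁻¹ q) :
    x = 1 := by
  have hinv : ∀ p, (x * y)⁻¹ (x p) = y⁻¹ p := by simp
  have hmono : StrictMono x := by
    intro p q hpq
    by_contra! hle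
    have hne : x q < x p := lt_of_le_of_ne hle fun e => hpq.ne' (x.injective e)
    have h1 := l.block_monotone hle
    rw [hx p, hx q] at h1
    have hb := le_antisymm (l.block_monotone hpq.le) h1
    have h2 := hxy _ _ hne (by rw [hx p, hx q, hb])
    rw [hinv, hinv] at h2
    exact h2.not_gt (hy p q hpq hb)
  have : hmono.orderIsoOfSurjective _ x.surjective = OrderIso.refl _ := Subsingleton.elim _ _
  ext p
  exact congrArg Fin.val (DFunLike.congr_fun this p)

/-- Induction along a Young subgroup, which is generated by the transpositions `(i  i+1)` that it
contains. -/
theorem young_induction {n r : ℕ} (l : Comp n r) {Q : Equiv.Perm (Fin r) → Prop} (one : Q 1)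
    (mul : ∀ i (h : i + 1 < r) y, adjSwap i h ∈ l.young → Q y → Q (adjSwap i h * y))
    (g : Equiv.Perm (Fin r)) (hg : g ∈ l.young) : Q g := by
  induction hd : len g using Nat.strong_induction_on generalizing g with
  | _ d ih =>
    by_cases hdesc : ∀ i (h : i + 1 < r),
      l.block ⟨i, (Nat.lt_succ_self i).trans h⟩ = l.block ⟨i + 1, h⟩ →
        g⁻¹ ⟨i, (Nat.lt_succ_self i).trans h⟩ < g⁻¹ ⟨i + 1, h⟩
    · rw [eq_one_of_inv_strictMonoOn_block l g 1 hg (fun p q hpq _ => by simpa using hpq)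
        (by simpa using inv_strictMonoOn_block l g hdesc)]
      exact one
    · push Not at hdesc
      obtain ⟨i, h, hb, hlt⟩ := hdesc
      have hs := adjSwap_mem_young l i h hb
      have hlt' := lt_of_le_of_ne hlt fun e => by simpa using g⁻¹.injective e
      have := mul i h _ hs (ih _ (hd ▸ len_adjSwap_mul_lt g i h hlt') (adjSwap i h * g)
        (mul_mem hs hg) rfl)
      rwa [← mul_assoc, Equiv.swap_mul_self, one_mul] at this

section MinRight

variable {n r : ℕ} (l : Comp n r) (H : Subgroup (Equiv.Perm (Fin r)))

theorem mem_minRight {K : Subgroup (Equiv.Perm (Fin r))} {y : Equiv.Perm (Fin r)} :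
    y ∈ minRight K H ↔ y ∈ H ∧ ∀ x ∈ K, len y ≤ len (x * y) := by
  simp [minRight]

theorem inv_strictMonoOn_of_mem_minRight {y : Equiv.Perm (Fin r)} (hy : y ∈ minRight l.young H) :
    ∀ p q : Fin r, p < q → l.block p = l.block q → y⁻¹ p < y⁻¹ q := by
  refine inv_strictMonoOn_block l y fun i h hb => ?_
  by_contra! hlt
  have hlt' := lt_of_le_of_ne hlt fun e => by simpa using y⁻¹.injective e
  exact (((mem_minRight H).1 hy).2 _ (adjSwap_mem_young l i h hb)).not_gt
    (len_adjSwap_mul_lt y i h hlt')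

/-- Every coset `S_l y` contains exactly one element of minimal length. -/
theorem existsUnique_minRight (hK : l.young ≤ H) {y : Equiv.Perm (Fin r)} (hy : y ∈ H) :
    ∃! z, z ∈ minRight l.young H ∧ z * y⁻¹ ∈ l.young := by
  classical
  obtain ⟨x, hx, hmin⟩ := Finset.exists_min_image
    (Finset.univ.filter (· ∈ l.young)) (fun x => len (x * y)) ⟨1, by simp [one_mem]⟩
  simp only [Finset.mem_filter, Finset.mem_univ, true_and] at hx hmin
  have hz : x * y ∈ minRight l.young H := (mem_minRight H).2 ⟨mul_mem (hK hx) hy, fun x' hx' => by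
    rw [← mul_assoc]
    exact hmin _ (mul_mem hx' hx)⟩
  refine ⟨x * y, ⟨hz, by simpa using hx⟩, ?_⟩
  rintro z ⟨hz', hzy⟩
  have hx' : z * (x * y)⁻¹ ∈ l.young := by
    rw [mul_inv_rev, ← mul_assoc]
    exact mul_mem hzy (inv_mem hx)
  have := eq_one_of_inv_strictMonoOn_block l _ _ hx' (inv_strictMonoOn_of_mem_minRight l H hz)
    (by simpa using inv_strictMonoOn_of_mem_minRight l H hz')
  exact mul_inv_eq_one.1 this

/-- A sum over minimal coset representatives of a function constant on the cosets is invariant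
under right translation. -/
theorem sum_minRight_mul {N : Type*} [AddCommMonoid N] (hK : l.young ≤ H)
    (F : Equiv.Perm (Fin r) → N) (hF : ∀ x ∈ l.young, ∀ y, F (x * y) = F y)
    {g : Equiv.Perm (Fin r)} (hg : g ∈ H) :
    ∑ y ∈ minRight l.young H, F (y * g) = ∑ y ∈ minRight l.young H, F y := by
  have hmem : ∀ {y}, y ∈ minRight l.young H → y ∈ H := fun hy => ((mem_minRight H).1 hy).1
  choose! ρ hρ hρu using fun y (hy : y ∈ H) => existsUnique_minRight l H hK hy
  have key : ∀ g ∈ H, ∀ y ∈ minRight l.young H, ρ (ρ (y * g) * g⁻¹) = y := by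
    intro g hg y hy
    have h1 := hρ (y * g) (mul_mem (hmem hy) hg)
    refine (hρu _ (mul_mem (hmem h1.1) (inv_mem hg)) y ⟨hy, ?_⟩).symm
    have := inv_mem h1.2
    simpa [mul_assoc] using this
  refine Finset.sum_nbij' (fun y => ρ (y * g)) (fun y => ρ (y * g⁻¹)) ?_ ?_ ?_ ?_ ?_
  · exact fun y hy => (hρ _ (mul_mem (hmem hy) hg)).1
  · exact fun y hy => (hρ _ (mul_mem (hmem hy) (inv_mem hg))).1
  · exact key g hg
  · intro y hy
    simpa using key g⁻¹ (inv_mem hg) y hy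
  · intro y hy
    rw [← hF _ (hρ (y * g) (mul_mem (hmem hy) hg)).2 (y * g), inv_mul_cancel_right]

end MinRight

/-! ### Divided differences -/

section DividedDifference

variable (k : Type u) [CommRing k] {r : ℕ}

/-- The coefficient of `x_j` in `x_a - x_b`. -/
def rootCoeff (a b j : Fin r) : k := if j = a then 1 else if j = b then -1 else 0

/-- The homomorphism `P_r → P_r[t]` with `x_a ↦ x_a + t`, `x_b ↦ x_b - t`, and `x_j ↦ x_j` for the
other `j`.  At `t = 0` it is the identity, at `t = x_b - x_a` it exchanges `x_a` and `x_b`. -/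
noncomputable def shearHom (a b : Fin r) :
    MvPolynomial (Fin r) k →ₐ[k] Polynomial (MvPolynomial (Fin r) k) :=
  MvPolynomial.aeval fun j => Polynomial.C (MvPolynomial.X j) +
    rootCoeff k a b j • Polynomial.X

/-- The divided difference `f ↦ (f - f^{(a b)}) / (x_a - x_b)`, see `dividedDiff_mul`.  It is
obtained without division: `f^{(a b)} - f` is the value at `t = x_b - x_a` of a polynomial in `t`
without constant term, see `shearHom`. -/
noncomputable def dividedDiff (a b : Fin r) :
    MvPolynomial (Fin r) k →ₗ[k] MvPolynomial (Fin r) k where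
  toFun f := (shearHom k a b f).divX.eval (MvPolynomial.X b - MvPolynomial.X a)
  map_add' f g := by rw [map_add, Polynomial.divX_add, Polynomial.eval_add]
  map_smul' c f := by
    have h : (c • shearHom k a b f).divX = c • (shearHom k a b f).divX := by
      ext1 n
      simp only [Polynomial.coeff_divX, Polynomial.coeff_smul]
    rw [map_smul, h, Polynomial.eval_smul, RingHom.id_apply]

variable {k} (a b : Fin r)

theorem X_swap (j : Fin r) :
    (MvPolynomial.X (Equiv.swap a b j) : MvPolynomial (Fin r) k) =
      MvPolynomial.X j - rootCoeff k a b j • (MvPolynomial.X a - MvPolynomial.X b) := by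
  unfold rootCoeff
  split_ifs with h1 h2
  · simp [h1]
  · simp [h2]
  · simp [Equiv.swap_apply_of_ne_of_ne h1 h2]

theorem shearHom_eval (f : MvPolynomial (Fin r) k) :
    (shearHom k a b f).eval (MvPolynomial.X b - MvPolynomial.X a) =
      MvPolynomial.rename (Equiv.swap a b) f := by
  induction f using MvPolynomial.induction_on with
  | C c =>
    rw [MvPolynomial.rename_C, ← MvPolynomial.algebraMap_eq, AlgHom.map_algebraMap,
      IsScalarTower.algebraMap_apply k (MvPolynomial (Fin r) k) (Polynomial _),
      Polynomial.algebraMap_eq, Polynomial.eval_C]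
  | add p q hp hq => rw [map_add, Polynomial.eval_add, hp, hq, map_add]
  | mul_X p j hp =>
    rw [map_mul, Polynomial.eval_mul, hp, map_mul, MvPolynomial.rename_X, X_swap a b, shearHom,
      MvPolynomial.aeval_X]
    simp only [Polynomial.eval_add, Polynomial.eval_C, Polynomial.eval_smul, Polynomial.eval_X,
      smul_sub]
    ring

theorem shearHom_coeff_zero (f : MvPolynomial (Fin r) k) : (shearHom k a b f).coeff 0 = f := by
  induction f using MvPolynomial.induction_on with
  | C c =>
    rw [← MvPolynomial.algebraMap_eq, AlgHom.map_algebraMap,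
      IsScalarTower.algebraMap_apply k (MvPolynomial (Fin r) k) (Polynomial _),
      Polynomial.algebraMap_eq, Polynomial.coeff_C_zero]
  | add p q hp hq => rw [map_add, Polynomial.coeff_add, hp, hq]
  | mul_X p j hp =>
    rw [map_mul, Polynomial.mul_coeff_zero, hp, shearHom, MvPolynomial.aeval_X]
    simp

theorem dividedDiff_mul (f : MvPolynomial (Fin r) k) :
    (MvPolynomial.X a - MvPolynomial.X b) * dividedDiff k a b f =
      f - MvPolynomial.rename (Equiv.swap a b) f := by
  have h := congrArg (Polynomial.eval (MvPolynomial.X b - MvPolynomial.X a))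
    (Polynomial.divX_mul_X_add (shearHom k a b f))
  rw [shearHom_eval a b, shearHom_coeff_zero, Polynomial.eval_add, Polynomial.eval_mul,
    Polynomial.eval_X, Polynomial.eval_C] at h
  rw [← h]
  simp only [dividedDiff, LinearMap.coe_mk, AddHom.coe_mk]
  ring

theorem dividedDiff_C (c : k) : dividedDiff k a b (MvPolynomial.C c) = 0 := by
  simp only [dividedDiff, LinearMap.coe_mk, AddHom.coe_mk]
  rw [← MvPolynomial.algebraMap_eq, AlgHom.map_algebraMap,
      IsScalarTower.algebraMap_apply k (MvPolynomial (Fin r) k) (Polynomial _),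
      Polynomial.algebraMap_eq, Polynomial.divX_C, Polynomial.eval_zero]

theorem dividedDiff_X_mul' (j : Fin r) (f : MvPolynomial (Fin r) k) :
    dividedDiff k a b (MvPolynomial.X j * f) = MvPolynomial.X j * dividedDiff k a b f +
      rootCoeff k a b j • MvPolynomial.rename (Equiv.swap a b) f := by
  have h : ((Polynomial.X : Polynomial (MvPolynomial (Fin r) k)) * shearHom k a b f).divX =
      shearHom k a b f := by
    ext1 n
    rw [Polynomial.coeff_divX, Polynomial.coeff_X_mul]
  have h2 : shearHom k a b (MvPolynomial.X j * f) =
      Polynomial.C (MvPolynomial.X j) * shearHom k a b f +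
        Polynomial.C (MvPolynomial.C (rootCoeff k a b j)) * (Polynomial.X * shearHom k a b f) := by
    rw [map_mul, shearHom, MvPolynomial.aeval_X, add_mul, ← mul_assoc]
    congr 2
    ext1 n
    rw [Polynomial.coeff_smul, Polynomial.coeff_C_mul, MvPolynomial.smul_eq_C_mul]
  simp only [dividedDiff, LinearMap.coe_mk, AddHom.coe_mk]
  rw [h2, Polynomial.divX_add, Polynomial.divX_C_mul, Polynomial.divX_C_mul, h,
    Polynomial.eval_add, Polynomial.eval_mul, Polynomial.eval_mul, shearHom_eval a b,
    Polynomial.eval_C, Polynomial.eval_C, MvPolynomial.smul_eq_C_mul]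

theorem dividedDiff_X_mul (j : Fin r) (f : MvPolynomial (Fin r) k) :
    dividedDiff k a b (MvPolynomial.X j * f) =
      MvPolynomial.X (Equiv.swap a b j) * dividedDiff k a b f + rootCoeff k a b j • f := by
  rw [dividedDiff_X_mul' a b, X_swap a b, sub_mul, smul_mul_assoc, dividedDiff_mul a b,
    smul_sub]
  ring

/-- Differences of variables are not zero divisors. -/
theorem eq_zero_of_X_sub_X_mul (hab : a ≠ b) {f : MvPolynomial (Fin r) k}
    (hf : (MvPolynomial.X a - MvPolynomial.X b) * f = 0) : f = 0 := by
  -- the automorphism `x_a ↦ x_a + x_b` reduces this to the variable `x_a`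
  let φ (c : k) : MvPolynomial (Fin r) k →ₐ[k] MvPolynomial (Fin r) k :=
    MvPolynomial.aeval fun j => if j = a then MvPolynomial.X a + c • MvPolynomial.X b
      else MvPolynomial.X j
  have hinv : (φ (-1)).comp (φ 1) = AlgHom.id k _ := by
    ext1 j
    by_cases hj : j = a
    · simp [φ, hj, hab.symm]
    · simp [φ, hj]
  have h := congrArg (φ 1) hf
  have h2 : φ 1 (MvPolynomial.X a - MvPolynomial.X b) = MvPolynomial.X a := by
    simp [φ, hab.symm]
  rw [map_mul, map_zero, h2] at h
  have h3 : φ 1 f = 0 := (MvPolynomial.isRegular_X (n := a)).left (by simpa using h)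
  have h4 := congrArg (φ (-1)) h3
  rwa [map_zero, ← AlgHom.comp_apply, hinv, AlgHom.id_apply] at h4

theorem dividedDiff_eq_zero (hab : a ≠ b) {f : MvPolynomial (Fin r) k}
    (hf : MvPolynomial.rename (Equiv.swap a b) f = f) : dividedDiff k a b f = 0 :=
  eq_zero_of_X_sub_X_mul a b hab (by rw [dividedDiff_mul a b, hf, sub_self])

end DividedDifference

/-! ### The action on polynomial-valued functions on words -/

section Words

variable (k : Type u) [CommRing k] (n r : ℕ)

/-- Functions on the words of length `r` in `n` letters with values in `P_r`; in other terms,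
`(k^n)^{⊗ r} ⊗ P_r`.  It carries a right action `wordRep` of `AH_r`, and contains the modules
`M(l) ⊗ AH_r`. -/
abbrev WordFun : Type u := (Fin r → Fin n) → MvPolynomial (Fin r) k

variable {k n r}

/-- Multiplication by `x_j`. -/
noncomputable def xOp (j : Fin r) : Module.End k (WordFun k n r) where
  toFun v w := MvPolynomial.X j * v w
  map_add' v v' := funext fun w => by simp only [Pi.add_apply, mul_add]
  map_smul' c v := funext fun w => by
    simp only [Pi.smul_apply, RingHom.id_apply, mul_smul_comm]

/-- The operator of the transposition `(a b)`: the permutation action on words and variables,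
corrected by the divided difference. -/
noncomputable def swapOp (a b : Fin r) : Module.End k (WordFun k n r) where
  toFun v w := MvPolynomial.rename (Equiv.swap a b) (v (w ∘ Equiv.swap a b)) +
    dividedDiff k a b (v w)
  map_add' v v' := by
    funext w
    simp only [Pi.add_apply, map_add]
    abel
  map_smul' c v := by
    funext w
    simp only [Pi.smul_apply, map_smul, RingHom.id_apply, smul_add]

theorem swapOp_apply (a b : Fin r) (v : WordFun k n r) (w) : swapOp a b v w =
    MvPolynomial.rename (Equiv.swap a b) (v (w ∘ Equiv.swap a b)) + dividedDiff k a b (v w) := rfl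

theorem xOp_apply (a : Fin r) (v : WordFun k n r) (w) : xOp a v w = MvPolynomial.X a * v w := rfl

theorem swapOp_xOp (a b j : Fin r) (v : WordFun k n r) :
    swapOp a b (xOp j v) =
      xOp (Equiv.swap a b j) (swapOp a b v) + rootCoeff k a b j • v := by
  funext w
  simp only [swapOp_apply, xOp_apply, map_mul, MvPolynomial.rename_X, dividedDiff_X_mul a b,
    Pi.add_apply, Pi.smul_apply]
  ring

theorem swapOp_const (a b : Fin r) (u : (Fin r → Fin n) → k) :
    swapOp a b (fun w => MvPolynomial.C (u w)) =
      fun w => MvPolynomial.C (u (w ∘ Equiv.swap a b)) := by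
  funext w
  simp only [swapOp_apply, MvPolynomial.rename_C, dividedDiff_C, add_zero]

/-- Linear operators agree if they agree on constant functions and their agreement propagates along
multiplication by the variables. -/
theorem wordFun_hom_ext {F G : Module.End k (WordFun k n r)}
    (hc : ∀ u : (Fin r → Fin n) → k, F (fun w => MvPolynomial.C (u w)) =
      G (fun w => MvPolynomial.C (u w)))
    (hx : ∀ j v, F v = G v → F (xOp j v) = G (xOp j v)) : F = G := by
  refine LinearMap.pi_ext fun w f => ?_
  induction f using MvPolynomial.induction_on with
  | C c =>
    convert hc (Pi.single w c) using 2 <;>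
    · funext w'
      by_cases hw : w' = w
      · simp [hw]
      · simp [hw]
  | add p q hp hq => rw [Pi.single_add, map_add, map_add, hp, hq]
  | mul_X p j hp =>
    convert hx j _ hp using 2 <;>
    · funext w'
      rw [xOp_apply, mul_comm,
        Pi.apply_single (fun _ g => MvPolynomial.X j * g) (fun _ => mul_zero _)]

theorem swapOp_swapOp {a b : Fin r} (hab : a ≠ b) (v : WordFun k n r) :
    swapOp a b (swapOp a b v) = v := by
  suffices swapOp a b * swapOp a b = (1 : Module.End k (WordFun k n r)) from
    LinearMap.congr_fun this v
  refine wordFun_hom_ext (fun u => ?_) fun j v hv => ?_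
  · simp [swapOp_const, Function.comp_assoc, ← Equiv.Perm.coe_mul]
  · simp only [Module.End.mul_apply, Module.End.one_apply] at hv ⊢
    simp only [swapOp_xOp, map_add, map_smul, Equiv.swap_apply_self, hv]
    have : rootCoeff k a b (Equiv.swap a b j) = - rootCoeff k a b j := by
      unfold rootCoeff
      by_cases h1 : j = a
      · simp [h1, hab.symm]
      · by_cases h2 : j = b
        · simp [h2, hab.symm]
        · simp [h1, h2, Equiv.swap_apply_of_ne_of_ne]
    rw [this, neg_smul]
    abel

theorem swapOp_commute {a b c d : Fin r} (hab : a ≠ b) (hcd : c ≠ d) (hac : a ≠ c) (had : a ≠ d)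
    (hbc : b ≠ c) (hbd : b ≠ d) :
    swapOp a b * swapOp c d = (swapOp c d * swapOp a b : Module.End k (WordFun k n r)) := by
  have hdisj : Equiv.swap a b * Equiv.swap c d = Equiv.swap c d * Equiv.swap a b :=
    (Equiv.Perm.Disjoint.commute (by
      rw [Equiv.Perm.disjoint_iff_disjoint_support, Equiv.Perm.support_swap hab,
        Equiv.Perm.support_swap hcd]
      simp [hac.symm, had.symm, hbc.symm, hbd.symm])).eq
  refine wordFun_hom_ext (fun u => ?_) fun j v hv => ?_
  · simp [swapOp_const, Function.comp_assoc, ← Equiv.Perm.coe_mul, hdisj]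
  · simp only [Module.End.mul_apply] at hv ⊢
    simp only [swapOp_xOp, map_add, map_smul, hv]
    have h1 : rootCoeff k a b (Equiv.swap c d j) = rootCoeff k a b j := by
      unfold rootCoeff
      by_cases h1 : j = c
      · simp [h1, hac.symm, had.symm, hbc.symm, hbd.symm]
      · by_cases h2 : j = d
        · simp [h2, hac.symm, had.symm, hbc.symm, hbd.symm]
        · simp [h1, h2, Equiv.swap_apply_of_ne_of_ne]
    have h2 : rootCoeff k c d (Equiv.swap a b j) = rootCoeff k c d j := by
      unfold rootCoeff
      by_cases h1 : j = a
      · simp [h1, hac, had, hbc, hbd]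
      · by_cases h2 : j = b
        · simp [h2, hac, had, hbc, hbd]
        · simp [h1, h2, Equiv.swap_apply_of_ne_of_ne]
    rw [h1, h2, ← Equiv.Perm.mul_apply, hdisj, Equiv.Perm.mul_apply]
    abel

theorem swapOp_braid {a b c : Fin r} (hab : a ≠ b) (hac : a ≠ c) (hbc : b ≠ c) :
    swapOp a b * swapOp b c * swapOp a b =
      (swapOp b c * swapOp a b * swapOp b c : Module.End k (WordFun k n r)) := by
  have hb := swap_braid hab hac hbc
  refine wordFun_hom_ext (fun u => ?_) fun j v hv => ?_
  · simp only [Module.End.mul_apply, swapOp_const, Function.comp_assoc, ← Equiv.Perm.coe_mul]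
    rw [← mul_assoc, hb, mul_assoc]
  · simp only [Module.End.mul_apply] at hv ⊢
    simp only [swapOp_xOp, map_add, map_smul, hv, swapOp_swapOp hab,
      swapOp_swapOp hbc]
    have hj := Equiv.Perm.ext_iff.1 hb j
    simp only [Equiv.Perm.mul_apply] at hj
    have h1 : rootCoeff k a b (Equiv.swap b c (Equiv.swap a b j)) = rootCoeff k b c j ∧
        rootCoeff k b c (Equiv.swap a b (Equiv.swap b c j)) = rootCoeff k a b j ∧
        rootCoeff k a b (Equiv.swap b c j) = rootCoeff k b c (Equiv.swap a b j) := by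
      unfold rootCoeff
      by_cases h1 : j = a
      · simp [h1, Equiv.swap_apply_def, hab, hac, hac.symm, hbc.symm]
      · by_cases h2 : j = b
        · simp [h2, Equiv.swap_apply_def, hab, hab.symm, hac, hac.symm, hbc.symm]
        · by_cases h3 : j = c
          · simp [h3, Equiv.swap_apply_def, hab, hab.symm, hac, hac.symm, hbc.symm]
          · simp [h1, h2, h3, Equiv.swap_apply_of_ne_of_ne]
    rw [h1.1, h1.2.1, h1.2.2, hj]
    abel

/-- The homomorphism of the right action of `AH_r` on word functions. -/
theorem exists_wordRep (k : Type u) [CommRing k] (n r : ℕ) :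
    ∃ ρ : AH k r →ₐ[k] (Module.End k (WordFun k n r))ᵐᵒᵖ,
      (∀ j, ρ (X k j) = op (xOp j)) ∧
      ∀ i h, ρ (T k i h) = op (swapOp ⟨i, (Nat.lt_succ_self i).trans h⟩ ⟨i + 1, h⟩) := by
  let φ : FreeAlgebra k (Gen r) →ₐ[k] (Module.End k (WordFun k n r))ᵐᵒᵖ :=
    FreeAlgebra.lift k fun g => match g with
      | Gen.x j => op (xOp j)
      | Gen.s i h => op (swapOp ⟨i, (Nat.lt_succ_self i).trans h⟩ ⟨i + 1, h⟩)
  have hx : ∀ j, φ (fx k j) = op (xOp j) := fun j => by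
    simp only [φ, fx, FreeAlgebra.lift_ι_apply]
  have hs : ∀ i h, φ (fs k i h) =
      op (swapOp ⟨i, (Nat.lt_succ_self i).trans h⟩ ⟨i + 1, h⟩) := fun i h => by
    simp only [φ, fs, FreeAlgebra.lift_ι_apply]
  have hne : ∀ i (h : i + 1 < r),
      (⟨i, (Nat.lt_succ_self i).trans h⟩ : Fin r) ≠ ⟨i + 1, h⟩ := by simp
  have hrel : ∀ ⦃x y⦄, Rel k r x y → φ x = φ y := by
    intro x y hxy
    cases hxy with
    | xx i j =>
      simp only [map_mul, hx, ← op_mul]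
      congr 1
      refine LinearMap.ext fun v => funext fun w => ?_
      simp only [Module.End.mul_apply, xOp_apply]
      ring
    | sq i h =>
      simp only [map_mul, hs, map_one, ← op_mul, ← op_one]
      congr 1
      exact LinearMap.ext fun v => swapOp_swapOp (hne i h) v
    | braid i h h' =>
      simp only [map_mul, hs, ← op_mul, ← mul_assoc]
      rw [swapOp_braid (hne i h) (by simp only [ne_eq, Fin.mk.injEq]; omega) (hne _ h')]
    | comm i j hi hj hij =>
      simp only [map_mul, hs, ← op_mul]
      rw [swapOp_commute (hne j hj) (hne i hi) _ _ _ _]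
      all_goals simp only [ne_eq, Fin.mk.injEq]; omega
    | sx i h =>
      simp only [map_mul, hs, hx, map_add, map_one, ← op_mul, ← op_add, ← op_one]
      congr 1
      refine LinearMap.ext fun v => ?_
      simp [swapOp_xOp, rootCoeff]
    | xs i h =>
      simp only [map_mul, hs, hx, map_add, map_one, ← op_mul, ← op_add, ← op_one]
      congr 1
      refine LinearMap.ext fun v => ?_
      simp [swapOp_xOp, rootCoeff]
    | xs_comm i j h h1 h2 =>
      simp only [map_mul, hs, hx, ← op_mul]
      congr 1
      refine LinearMap.ext fun v => ?_
      have e1 : i ≠ ⟨j, (Nat.lt_succ_self j).trans h⟩ := fun e => h1 (congrArg Fin.val e)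
      have e2 : i ≠ ⟨j + 1, h⟩ := fun e => h2 (congrArg Fin.val e)
      simp [swapOp_xOp, rootCoeff, e1, e2, Equiv.swap_apply_of_ne_of_ne]
  refine ⟨RingQuot.liftAlgHom k ⟨φ, hrel⟩, fun j => ?_, fun i h => ?_⟩
  · rw [X, RingQuot.liftAlgHom_mkAlgHom_apply, hx]
  · rw [T, RingQuot.liftAlgHom_mkAlgHom_apply, hs]

variable (k n r) in
/-- The right action of `AH_r` on word functions. -/
noncomputable def wordRep : AH k r →ₐ[k] (Module.End k (WordFun k n r))ᵐᵒᵖ :=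
  (exists_wordRep k n r).choose

theorem wordRep_X (j : Fin r) (v : WordFun k n r) :
    (wordRep k n r (X k j)).unop v = xOp j v := by
  rw [wordRep, (exists_wordRep k n r).choose_spec.1, unop_op]

theorem wordRep_adjSwap (i : ℕ) (h : i + 1 < r) (v : WordFun k n r) :
    (wordRep k n r (permToAH k r (adjSwap i h))).unop v =
      swapOp ⟨i, (Nat.lt_succ_self i).trans h⟩ ⟨i + 1, h⟩ v := by
  rw [permToAH_swap, wordRep, (exists_wordRep k n r).choose_spec.2, unop_op]

theorem wordRep_mul (a b : AH k r) (v : WordFun k n r) :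
    (wordRep k n r (a * b)).unop v = (wordRep k n r b).unop ((wordRep k n r a).unop v) := by
  rw [map_mul, unop_mul, Module.End.mul_apply]

theorem wordRep_poly (f : MvPolynomial (Fin r) k) (v : WordFun k n r) (w) :
    (wordRep k n r (polyToAH k r f)).unop v w = f * v w := by
  induction f using MvPolynomial.induction_on generalizing v with
  | C c =>
    rw [← MvPolynomial.algebraMap_eq, AlgHom.map_algebraMap, AlgHom.map_algebraMap,
      MulOpposite.algebraMap_apply, unop_op, Module.algebraMap_end_apply, Pi.smul_apply,
      Algebra.smul_def]
  | add p q hp hq => rw [map_add, map_add, unop_add, LinearMap.add_apply, Pi.add_apply, hp, hq,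
      add_mul]
  | mul_X p j hp =>
    rw [map_mul, wordRep_mul, polyToAH_X, wordRep_X, xOp_apply, hp]
    ring

theorem perm_induction {Q : Equiv.Perm (Fin r) → Prop} (one : Q 1)
    (mul : ∀ g i (h : i + 1 < r), Q g → Q (g * adjSwap i h)) (g : Equiv.Perm (Fin r)) : Q g := by
  cases r with
  | zero => rwa [Subsingleton.elim g 1]
  | succ N =>
    have hg : g ∈ Submonoid.closure
        (Set.range fun i : Fin N => Equiv.swap i.castSucc i.succ) := by
      rw [Equiv.Perm.mclosure_swap_castSucc_succ]
      trivial
    induction hg using Submonoid.closure_induction_right with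
    | one => exact one
    | mul_right x _ y hy ih =>
      obtain ⟨i, rfl⟩ := hy
      exact mul x i (by omega) ih

/-- On functions with constant values, `S_r` acts by permuting the letters of the words. -/
theorem wordRep_perm_const (g : Equiv.Perm (Fin r)) (u : (Fin r → Fin n) → k) :
    (wordRep k n r (permToAH k r g)).unop (fun w => MvPolynomial.C (u w)) =
      fun w => MvPolynomial.C (u (w ∘ ⇑g⁻¹)) := by
  induction g using perm_induction with
  | one => simp
  | mul g i h ih =>
    rw [map_mul, wordRep_mul, ih, wordRep_adjSwap, swapOp_const _ _ fun w => u (w ∘ ⇑g⁻¹)]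
    simp only [Function.comp_assoc, ← Equiv.Perm.coe_mul, mul_inv_rev, Equiv.swap_inv]

end Words

/-! ### Straightening in the degenerate affine Hecke algebra -/

section Straightening

variable {k : Type u} [CommRing k] {r : ℕ}

theorem X_mul_adjSwap (j : Fin r) (i : ℕ) (h : i + 1 < r) :
    X k j * permToAH k r (adjSwap i h) =
      permToAH k r (adjSwap i h) * X k (adjSwap i h j) +
        rootCoeff k ⟨i, (Nat.lt_succ_self i).trans h⟩ ⟨i + 1, h⟩ j • 1 := by
  rw [permToAH_swap]
  unfold rootCoeff
  by_cases h1 : j = ⟨i, (Nat.lt_succ_self i).trans h⟩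
  · have e := RingQuot.mkAlgHom_rel k (Rel.xs (k := k) i h)
    simp only [map_mul, map_add, map_one] at e
    rw [h1, Equiv.swap_apply_left, if_pos rfl, one_smul]
    exact e
  · by_cases h2 : j = ⟨i + 1, h⟩
    · have e := RingQuot.mkAlgHom_rel k (Rel.sx (k := k) i h)
      simp only [map_mul, map_add, map_one] at e
      rw [if_neg h1, if_pos h2, h2, Equiv.swap_apply_right, neg_smul (1 : k) (1 : AH k r), one_smul,
        eq_add_neg_iff_add_eq]
      exact e.symm
    · have e := RingQuot.mkAlgHom_rel k (Rel.xs_comm (k := k) j i h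
        (fun e => h1 (Fin.ext e)) (fun e => h2 (Fin.ext e)))
      simp only [map_mul] at e
      rw [if_neg h1, if_neg h2, zero_smul, add_zero, Equiv.swap_apply_of_ne_of_ne h1 h2]
      exact e

/-- The commutation relation `f s_i = s_i f^{s_i} + ∂_i f`. -/
theorem poly_mul_adjSwap (f : MvPolynomial (Fin r) k) (i : ℕ) (h : i + 1 < r) :
    polyToAH k r f * permToAH k r (adjSwap i h) =
      permToAH k r (adjSwap i h) * polyToAH k r (MvPolynomial.rename (adjSwap i h) f) +
        polyToAH k r (dividedDiff k ⟨i, (Nat.lt_succ_self i).trans h⟩ ⟨i + 1, h⟩ f) := by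
  induction f using MvPolynomial.induction_on with
  | C c =>
    rw [MvPolynomial.rename_C, dividedDiff_C, map_zero, add_zero, ← MvPolynomial.algebraMap_eq,
      AlgHom.map_algebraMap, Algebra.commutes]
  | add p q hp hq =>
    simp only [map_add, add_mul, mul_add, hp, hq]
    abel
  | mul_X p j hp =>
    rw [map_mul, polyToAH_X, mul_assoc, X_mul_adjSwap, mul_add, ← mul_assoc, hp, map_mul,
      MvPolynomial.rename_X, map_mul, polyToAH_X, mul_comm p, dividedDiff_X_mul, map_add, map_smul,
      mul_comm (MvPolynomial.X _), map_mul, polyToAH_X, add_mul, mul_assoc, mul_smul_comm, mul_one]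
    abel

/-- Polynomials that are invariant under a Young subgroup commute with it in `AH_r`. -/
theorem invariants_commute {n : ℕ} (l : Comp n r) {f : MvPolynomial (Fin r) k}
    (hf : f ∈ invariants k l) {g : Equiv.Perm (Fin r)} (hg : g ∈ l.young) :
    polyToAH k r f * permToAH k r g = permToAH k r g * polyToAH k r f := by
  refine young_induction l (Q := fun g => polyToAH k r f * permToAH k r g =
    permToAH k r g * polyToAH k r f) ?_ (fun i h y hs ih => ?_) g hg
  · rw [map_one, one_mul, mul_one]
  · have hfs := hf _ hs
    rw [map_mul, ← mul_assoc, poly_mul_adjSwap, hfs,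
      dividedDiff_eq_zero _ _ (by simp) hfs, map_zero, add_zero, mul_assoc, ih, mul_assoc]

/-- `AH_r` is additively generated by the products `g f` with `g ∈ S_r` and `f ∈ P_r`. -/
theorem AH_induction {Q : AH k r → Prop} (add : ∀ a b, Q a → Q b → Q (a + b))
    (mk : ∀ g f, Q (permToAH k r g * polyToAH k r f)) (a : AH k r) : Q a := by
  let S : AddSubmonoid (AH k r) :=
    AddSubmonoid.closure (Set.range fun p : Equiv.Perm (Fin r) × MvPolynomial (Fin r) k =>
      permToAH k r p.1 * polyToAH k r p.2)
  have hS : ∀ g f, permToAH k r g * polyToAH k r f ∈ S := fun g f =>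
    AddSubmonoid.subset_closure ⟨(g, f), rfl⟩
  have key : ∀ b, (∀ g f, permToAH k r g * polyToAH k r f * b ∈ S) → ∀ s ∈ S, s * b ∈ S := by
    intro b hb s hs
    induction hs using AddSubmonoid.closure_induction with
    | mem x hx =>
      obtain ⟨p, rfl⟩ := hx
      exact hb _ _
    | zero => rw [zero_mul]; exact zero_mem _
    | add x y _ _ hx hy => rw [add_mul]; exact add_mem hx hy
  have main : ∀ z : FreeAlgebra k (Gen r), ∀ s ∈ S, s * RingQuot.mkAlgHom k (Rel k r) z ∈ S := by
    intro z
    induction z using FreeAlgebra.induction with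
    | grade0 c =>
      refine key _ fun g f => ?_
      rw [AlgHom.map_algebraMap, mul_assoc, ← Algebra.commutes, ← Algebra.smul_def, ← map_smul]
      exact hS _ _
    | grade1 x =>
      refine key _ fun g f => ?_
      cases x with
      | x j =>
        have : RingQuot.mkAlgHom k (Rel k r) (FreeAlgebra.ι k (Gen.x j)) =
          polyToAH k r (MvPolynomial.X j) := (polyToAH_X k r j).symm
        rw [this, mul_assoc, ← map_mul]
        exact hS _ _
      | s i h =>
        have : RingQuot.mkAlgHom k (Rel k r) (FreeAlgebra.ι k (Gen.s i h)) =
          permToAH k r (adjSwap i h) := (permToAH_swap k r i h).symm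
        rw [this, mul_assoc, poly_mul_adjSwap, mul_add, ← mul_assoc, ← map_mul]
        exact add_mem (hS _ _) (hS _ _)
    | mul x y hx hy =>
      intro s hs
      rw [map_mul, ← mul_assoc]
      exact hy _ (hx _ hs)
    | add x y hx hy =>
      intro s hs
      rw [map_add, mul_add]
      exact add_mem (hx _ hs) (hy _ hs)
  obtain ⟨z, rfl⟩ := RingQuot.mkAlgHom_surjective k (Rel k r) a
  have ha := main z 1 (by simpa using hS 1 1)
  rw [one_mul] at ha
  generalize RingQuot.mkAlgHom k (Rel k r) z = a at ha
  induction ha using AddSubmonoid.closure_induction with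
  | mem x hx =>
    obtain ⟨p, rfl⟩ := hx
    exact mk _ _
  | zero => simpa using mk 1 0
  | add x y _ _ hx hy => exact add _ _ hx hy

end Straightening

/-! ### Induced modules -/

section Ind

variable {k : Type u} [CommRing k] {R : Type v} [Ring R] [Algebra k R] {S : Type w} [Ring S]
  [Algebra k S] (φ : R →ₐ[k] S) {M : Type v} [AddCommGroup M] [Module k M] [Module Rᵐᵒᵖ M]

theorem Ind.smul_tmul (m : M) (b s : S) : op s • Ind.tmul φ m b = Ind.tmul φ m (b * s) := rfl

theorem Ind.tmul_smul (m : M) (a : R) (b : S) :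
    Ind.tmul φ (op a • m) b = Ind.tmul φ m (φ a * b) := by
  refine (Submodule.Quotient.eq _).2 (Submodule.subset_span ⟨m, a, b, rfl⟩)

theorem Ind.tmul_add (m : M) (b c : S) :
    Ind.tmul φ m (b + c) = Ind.tmul φ m b + Ind.tmul φ m c := by
  rw [Ind.tmul, TensorProduct.add_tmul]
  rfl

/-- A module induced from a cyclic module is cyclic. -/
theorem Ind.exists_eq_tmul {m₀ : M} (h : ∀ m, ∃ a : R, m = op a • m₀) (z : Ind φ M) :
    ∃ b, z = Ind.tmul φ m₀ b := by
  obtain ⟨z, rfl⟩ := Submodule.Quotient.mk_surjective _ z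
  induction z using TensorProduct.induction_on with
  | zero => exact ⟨0, by rw [Ind.tmul, TensorProduct.zero_tmul]⟩
  | tmul b m =>
    obtain ⟨a, rfl⟩ := h m
    exact ⟨φ a * b, Ind.tmul_smul φ m₀ a b⟩
  | add x y hx hy =>
    obtain ⟨b, hb⟩ := hx
    obtain ⟨c, hc⟩ := hy
    refine ⟨b + c, ?_⟩
    rw [Ind.tmul_add, ← hb, ← hc]
    rfl

/-- The universal property of induced modules.  The right action of `S` on the target is given by
the operators `α`. -/
theorem Ind.exists_lift {N : Type*} [AddCommGroup N] [Module k N]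
    (α : S →ₐ[k] (Module.End k N)ᵐᵒᵖ) (h : M →ₗ[k] N)
    (hh : ∀ m a, h (op a • m) = (α (φ a)).unop (h m)) :
    ∃ F : Ind φ M →ₗ[k] N, (∀ m b, F (Ind.tmul φ m b) = (α b).unop (h m)) ∧
      ∀ z s, F (op s • z) = (α s).unop (F z) := by
  let F₀ : S ⊗[k] M →ₗ[k] N := TensorProduct.lift
    (LinearMap.lcomp k N h ∘ₗ (opLinearEquiv k).symm.toLinearMap ∘ₗ α.toLinearMap)
  have hF : ∀ b m, F₀ (b ⊗ₜ[k] m) = (α b).unop (h m) := fun b m => rfl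
  have hs : ∀ (z : S ⊗[k] M) s, F₀ (op s • z) = (α s).unop (F₀ z) := by
    intro z s
    induction z using TensorProduct.induction_on with
    | zero => rw [smul_zero, map_zero, map_zero]
    | tmul b m =>
      rw [TensorProduct.smul_tmul', hF, hF, op_smul_eq_mul, map_mul, unop_mul,
        Module.End.mul_apply]
    | add x y hx hy => rw [smul_add, map_add, map_add, hx, hy, map_add]
  have hker : ∀ z ∈ balance φ M, F₀ z = 0 := by
    intro z hz
    induction hz using Submodule.span_induction with
    | mem x hx =>
      obtain ⟨m, a, b, rfl⟩ := hx
      rw [map_sub, hF, hF, hh, map_mul, unop_mul, Module.End.mul_apply, sub_self]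
    | zero => exact map_zero _
    | add x y _ _ hx hy => rw [map_add, hx, hy, add_zero]
    | smul s x _ hx => rw [← op_unop s, hs, hx, map_zero]
  let F : Ind φ M →ₗ[k] N :=
    { toFun := Quotient.lift (fun z => F₀ z) (by
        intro x y hxy
        have h1 := hker _ ((Submodule.quotientRel_def _).1 hxy)
        rwa [map_sub, sub_eq_zero] at h1)
      map_add' := by
        intro x y
        obtain ⟨x, rfl⟩ := Submodule.Quotient.mk_surjective _ x
        obtain ⟨y, rfl⟩ := Submodule.Quotient.mk_surjective _ y
        exact map_add F₀ x y
      map_smul' := by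
        intro c x
        obtain ⟨x, rfl⟩ := Submodule.Quotient.mk_surjective _ x
        exact map_smul F₀ c x }
  refine ⟨F, fun m b => hF b m, fun z s => ?_⟩
  · obtain ⟨z, rfl⟩ := Submodule.Quotient.mk_surjective _ z
    exact hs z s

end Ind

section AffMod

variable {k : Type u} [CommRing k] {n r : ℕ} (l : Comp n r)

theorem affElt_mul (a b : AH k r) : affElt k l (a * b) = op b • affElt k l a := rfl

theorem affElt_add (a b : AH k r) : affElt k l (a + b) = affElt k l a + affElt k l b :=
  Ind.tmul_add _ _ _ _

theorem affElt_csmul (c : k) (a : AH k r) : affElt k l (c • a) = c • affElt k l a := rfl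

theorem triv_smul (g : l.young) (c : k) (m : Triv k l.young) :
    op (MonoidAlgebra.single g c) • m = c • m := by
  change (MonoidAlgebra.lift k k l.young (1 : l.young →* k)) (MonoidAlgebra.single g c) *
    (show k from m) = c * (show k from m)
  rw [MonoidAlgebra.lift_single, MonoidHom.one_apply, smul_eq_mul, mul_one]

theorem permGen_smul {g : Equiv.Perm (Fin r)} (hg : g ∈ l.young) :
    op (MonoidAlgebra.single g (1 : k)) • permGen k l = permGen k l := by
  have : MonoidAlgebra.single g (1 : k) =
      youngIncl k l (MonoidAlgebra.single (⟨g, hg⟩ : l.young) 1) := by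
    simp [youngIncl]
  rw [permGen, Ind.smul_tmul, one_mul, this, ← mul_one (youngIncl k l _), ← Ind.tmul_smul,
    triv_smul, one_smul]

theorem affElt_young_mul {g : Equiv.Perm (Fin r)} (hg : g ∈ l.young) (a : AH k r) :
    affElt k l (permToAH k r g * a) = affElt k l a := by
  have : permToAH k r g = groupToAH k r (MonoidAlgebra.single g 1) := by
    rw [groupToAH, MonoidAlgebra.lift_single, one_smul]
  rw [affElt, this, ← Ind.tmul_smul, permGen_smul l hg, affElt]

theorem exists_eq_affElt (z : AffMod k l) : ∃ a, z = affElt k l a := by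
  refine Ind.exists_eq_tmul _ (fun m => ?_) z
  obtain ⟨a, rfl⟩ := Ind.exists_eq_tmul (youngIncl k l) (m₀ := Triv.one k l.young)
    (fun c => ⟨MonoidAlgebra.single 1 (show k from c),
      by rw [triv_smul]; exact (mul_one (show k from c)).symm⟩) m
  exact ⟨a, by rw [permGen, Ind.smul_tmul, one_mul]⟩

/-- `S_l`-invariant vectors are the images of `m_l ⊗ 1` under homomorphisms of right modules. -/
theorem exists_affMod_lift {N : Type*} [AddCommGroup N] [Module k N]
    (α : AH k r →ₐ[k] (Module.End k N)ᵐᵒᵖ) (v : N)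
    (hv : ∀ g ∈ l.young, (α (permToAH k r g)).unop v = v) :
    ∃ F : AffMod k l →ₗ[k] N, (∀ a, F (affElt k l a) = (α a).unop v) ∧
      ∀ z s, F (op s • z) = (α s).unop (F z) := by
  obtain ⟨h₀, hone, hall⟩ : ∃ h₀ : Triv k l.young →ₗ[k] N, h₀ (Triv.one k l.young) = v ∧
      ∀ m, ∃ c : k, h₀ m = c • v :=
    ⟨LinearMap.toSpanSingleton k N v, one_smul k v, fun m => ⟨show k from m, rfl⟩⟩
  obtain ⟨F₁, h1, h2⟩ := Ind.exists_lift (youngIncl k l) (α.comp (groupToAH k r)) h₀ fun m a => by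
    induction a using MonoidAlgebra.induction_linear with
    | zero => simp
    | add a b ha hb => simp only [op_add, add_smul, map_add, ha, hb, unop_add, LinearMap.add_apply]
    | single g c =>
      have : groupToAH k r (youngIncl k l (MonoidAlgebra.single g c)) =
          c • permToAH k r g := by
        simp [youngIncl, groupToAH, MonoidAlgebra.lift_single]
      obtain ⟨d, hd⟩ := hall m
      rw [triv_smul, map_smul, AlgHom.comp_apply, this, map_smul, unop_smul,
        LinearMap.smul_apply, hd, map_smul, hv _ g.2]
  obtain ⟨F, h3, h4⟩ := Ind.exists_lift (groupToAH k r) (M := PermMod k l) α F₁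
    (fun m a => h2 m a)
  refine ⟨F, fun a => (h3 _ _).trans ?_, h4⟩
  rw [permGen, h1, map_one, unop_one, Module.End.one_apply, hone]

theorem affHom_ext {N : Type*} [AddCommGroup N] [Module (AH k r)ᵐᵒᵖ N]
    {F G : AffMod k l →ₗ[(AH k r)ᵐᵒᵖ] N} (h : F (affElt k l 1) = G (affElt k l 1)) : F = G := by
  ext z
  obtain ⟨a, rfl⟩ := exists_eq_affElt l z
  rw [← one_mul a, affElt_mul, map_smul, map_smul, h]

theorem exists_affHom {mu lam : Comp n r} (v : AffMod k lam)
    (hv : ∀ g ∈ mu.young, op (permToAH k r g) • v = v) :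
    ∃ F : AffHom k mu lam, F (affElt k mu 1) = v := by
  obtain ⟨F, h1, h2⟩ := exists_affMod_lift mu
    (AlgHom.opComm.symm (Algebra.lsmul k k (AffMod k lam))) v hv
  exact ⟨{ F with map_smul' := fun s z => h2 z s.unop }, (h1 1).trans (one_smul _ v)⟩

end AffMod

/-! ### The degree filtration -/

section LowDeg

variable (k : Type u) [CommRing k] {r : ℕ}

/-- The polynomials all of whose terms have degree `< D`. -/
def lowDeg (D : ℕ) : Submodule k (MvPolynomial (Fin r) k) where
  carrier := {f | ∀ m, D ≤ m.degree → f.coeff m = 0}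
  add_mem' hf hg m hm := by rw [MvPolynomial.coeff_add, hf m hm, hg m hm, add_zero]
  zero_mem' m _ := MvPolynomial.coeff_zero m
  smul_mem' c f hf m hm := by rw [MvPolynomial.coeff_smul, hf m hm, smul_zero]

variable {k}

theorem lowDeg_mono {D E : ℕ} (h : D ≤ E) :
    lowDeg k D ≤ (lowDeg k E : Submodule k (MvPolynomial (Fin r) k)) :=
  fun _ hf m hm => hf m (h.trans hm)

theorem eq_zero_of_mem_lowDeg_zero {f : MvPolynomial (Fin r) k} (hf : f ∈ lowDeg k 0) : f = 0 :=
  MvPolynomial.ext _ _ fun m => by rw [hf m (Nat.zero_le _), MvPolynomial.coeff_zero]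

theorem mem_lowDeg_totalDegree (f : MvPolynomial (Fin r) k) : f ∈ lowDeg k (f.totalDegree + 1) :=
  fun m hm => MvPolynomial.coeff_eq_zero_of_totalDegree_lt (by
    rw [← Finsupp.degree_apply]; exact hm)

theorem X_mul_mem_lowDeg {D : ℕ} (j : Fin r) {f : MvPolynomial (Fin r) k} (hf : f ∈ lowDeg k D) :
    MvPolynomial.X j * f ∈ lowDeg k (D + 1) := by
  classical
  intro m hm
  rw [MvPolynomial.coeff_X_mul']
  split_ifs with hj
  · refine hf _ ?_
    obtain ⟨m, rfl⟩ : ∃ m', m = m' + Finsupp.single j 1 :=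
      ⟨m - Finsupp.single j 1, (tsub_add_cancel_of_le (Finsupp.single_le_iff.2
        (Nat.one_le_iff_ne_zero.2 (Finsupp.mem_support_iff.1 hj)))).symm⟩
    rw [map_add, Finsupp.degree_single] at hm
    rw [add_tsub_cancel_right]
    omega
  · rfl

theorem rename_mem_lowDeg {D : ℕ} (g : Equiv.Perm (Fin r)) {f : MvPolynomial (Fin r) k}
    (hf : f ∈ lowDeg k D) : MvPolynomial.rename g f ∈ lowDeg k D := by
  intro m hm
  refine MvPolynomial.coeff_rename_eq_zero _ _ _ fun m' h => hf m' ?_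
  rwa [← Finsupp.degree_mapDomain g m', h]

theorem dividedDiff_monomial_mem_lowDeg (a b : Fin r) (m : Fin r →₀ ℕ) (c : k) :
    dividedDiff k a b (MvPolynomial.monomial m c) ∈ lowDeg k m.degree := by
  induction hd : m.degree generalizing m with
  | zero =>
    rw [(Finsupp.degree_eq_zero_iff m).1 hd, ← MvPolynomial.C_apply, dividedDiff_C]
    exact zero_mem _
  | succ d ih =>
    obtain ⟨j, hj⟩ : ∃ j, m j ≠ 0 := by
      by_contra! h
      rw [show m = 0 from Finsupp.ext h, map_zero] at hd
      omega
    obtain ⟨m, rfl⟩ : ∃ m', m = Finsupp.single j 1 + m' :=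
      ⟨m - Finsupp.single j 1, (add_tsub_cancel_of_le (Finsupp.single_le_iff.2
        (Nat.one_le_iff_ne_zero.2 hj))).symm⟩
    rw [map_add, Finsupp.degree_single] at hd
    have hm : MvPolynomial.monomial (Finsupp.single j 1 + m) c =
        MvPolynomial.X j * MvPolynomial.monomial m c := by
      rw [MvPolynomial.X, MvPolynomial.monomial_mul, one_mul]
    rw [hm, dividedDiff_X_mul]
    refine add_mem (X_mul_mem_lowDeg _ (ih m (by omega))) (Submodule.smul_mem _ _ ?_)
    intro m' hm'
    rw [MvPolynomial.coeff_monomial, if_neg]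
    rintro rfl
    omega

/-- Divided differences lower degrees. -/
theorem dividedDiff_mem_lowDeg {D : ℕ} (a b : Fin r) {f : MvPolynomial (Fin r) k}
    (hf : f ∈ lowDeg k (D + 1)) : dividedDiff k a b f ∈ lowDeg k D := by
  rw [f.as_sum, map_sum]
  refine Submodule.sum_mem _ fun m hm => lowDeg_mono ?_ (dividedDiff_monomial_mem_lowDeg a b m _)
  by_contra! h
  exact MvPolynomial.mem_support_iff.1 hm (hf m h)

theorem homogeneousComponent_eq_zero_of_mem_lowDeg {D : ℕ} {f : MvPolynomial (Fin r) k}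
    (hf : f ∈ lowDeg k D) : MvPolynomial.homogeneousComponent D f = 0 :=
  MvPolynomial.homogeneousComponent_eq_zero' _ _ fun m hm h =>
    MvPolynomial.mem_support_iff.1 hm (hf m h.ge)

theorem homogeneousComponent_mem_lowDeg (D : ℕ) (f : MvPolynomial (Fin r) k) :
    MvPolynomial.homogeneousComponent D f ∈ lowDeg k (D + 1) := by
  intro m hm
  rw [MvPolynomial.coeff_homogeneousComponent, if_neg (by omega)]

theorem sub_homogeneousComponent_mem_lowDeg {D : ℕ} {f : MvPolynomial (Fin r) k}
    (hf : f ∈ lowDeg k (D + 1)) : f - MvPolynomial.homogeneousComponent D f ∈ lowDeg k D := by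
  intro m hm
  rw [MvPolynomial.coeff_sub, MvPolynomial.coeff_homogeneousComponent]
  split_ifs with h
  · rw [sub_self]
  · rw [sub_zero, hf m (by omega)]

variable {n : ℕ}

/-- Up to terms of lower degree, `S_r` acts on word functions by permuting the letters and the
variables. -/
theorem wordRep_perm_sub_mem_lowDeg {D : ℕ} {v : WordFun k n r} (hv : ∀ w, v w ∈ lowDeg k (D + 1))
    (g : Equiv.Perm (Fin r)) (w : Fin r → Fin n) :
    (wordRep k n r (permToAH k r g)).unop v w -
      MvPolynomial.rename ⇑g⁻¹ (v (w ∘ ⇑g⁻¹)) ∈ lowDeg k D := by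
  induction g using perm_induction generalizing w with
  | one => simp
  | mul g i h ih =>
    rw [map_mul, wordRep_mul, wordRep_adjSwap, swapOp_apply]
    set v' := (wordRep k n r (permToAH k r g)).unop v
    have hv' : ∀ w, v' w ∈ lowDeg k (D + 1) := fun w => by
      have := add_mem (lowDeg_mono (Nat.le_succ D) (ih w)) (rename_mem_lowDeg g⁻¹ (hv (w ∘ ⇑g⁻¹)))
      rwa [sub_add_cancel] at this
    have h1 := rename_mem_lowDeg (adjSwap i h) (ih (w ∘ ⇑(adjSwap i h)))
    have h2 := dividedDiff_mem_lowDeg ⟨i, (Nat.lt_succ_self i).trans h⟩ ⟨i + 1, h⟩ (hv' w)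
    convert add_mem h1 h2 using 1
    rw [map_sub, MvPolynomial.rename_rename, mul_inv_rev, Equiv.swap_inv, Equiv.Perm.coe_mul,
      Function.comp_assoc]
    ring

theorem wordRep_perm_mem_lowDeg {D : ℕ} {v : WordFun k n r} (hv : ∀ w, v w ∈ lowDeg k (D + 1))
    (g : Equiv.Perm (Fin r)) (w : Fin r → Fin n) :
    (wordRep k n r (permToAH k r g)).unop v w ∈ lowDeg k (D + 1) := by
  have := add_mem (lowDeg_mono (Nat.le_succ D) (wordRep_perm_sub_mem_lowDeg hv g w))
    (rename_mem_lowDeg g⁻¹ (hv (w ∘ ⇑g⁻¹)))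
  rwa [sub_add_cancel] at this

end LowDeg

/-! ### Induced permutation modules as word functions -/

section ToWord

variable {k : Type u} [CommRing k] {n r : ℕ} (l : Comp n r)

theorem comp_perm_eq_iff {α : Type*} {w w' : Fin r → α} (g : Equiv.Perm (Fin r)) :
    w ∘ ⇑g⁻¹ = w' ↔ w = w' ∘ g := by
  constructor
  · rintro rfl
    funext p
    simp
  · rintro rfl
    funext p
    simp

open Classical in
theorem wordRep_perm_poly_single (w₀ : Fin r → Fin n) (g : Equiv.Perm (Fin r))
    (f : MvPolynomial (Fin r) k) (w : Fin r → Fin n) :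
    (wordRep k n r (permToAH k r g * polyToAH k r f)).unop
      (fun w => MvPolynomial.C (if w = w₀ then 1 else 0)) w =
      if w = w₀ ∘ g then f else 0 := by
  rw [wordRep_mul, wordRep_poly, wordRep_perm_const g fun w => if w = w₀ then (1 : k) else 0]
  simp only [comp_perm_eq_iff]
  split_ifs <;> simp

open Classical in
theorem exists_toWord : ∃ F : AffMod k l →ₗ[k] WordFun k n r,
    (∀ a, F (affElt k l a) = (wordRep k n r a).unop
      (fun w => MvPolynomial.C (if w = l.block then 1 else 0))) ∧
    ∀ z s, F (op s • z) = (wordRep k n r s).unop (F z) := by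
  refine exists_affMod_lift l (wordRep k n r) _ fun g hg => ?_
  rw [wordRep_perm_const g fun w => if w = l.block then (1 : k) else 0]
  simp only [comp_perm_eq_iff]
  rw [show l.block ∘ g = l.block from funext hg]

/-- The embedding of `M(l) ⊗ AH_r` into the word functions; it maps `m_l ⊗ 1` to the indicator
function of the word `0 ⋯ 0 1 ⋯ 1 ⋯` of the blocks of `l`. -/
noncomputable def toWord : AffMod k l →ₗ[k] WordFun k n r := (exists_toWord l).choose

theorem toWord_smul (z : AffMod k l) (s : AH k r) :
    toWord l (op s • z) = (wordRep k n r s).unop (toWord l z) :=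
  (exists_toWord l).choose_spec.2 z s

open Classical in
theorem toWord_affElt (g : Equiv.Perm (Fin r)) (f : MvPolynomial (Fin r) k) (w) :
    toWord l (affElt k l (permToAH k r g * polyToAH k r f)) w =
      if w = l.block ∘ g then f else 0 := by
  rw [toWord, (exists_toWord l).choose_spec.1]
  exact wordRep_perm_poly_single _ _ _ _

theorem toWord_eq_zero (z : AffMod k l) (w) (hw : ∀ g : Equiv.Perm (Fin r), w ≠ l.block ∘ g) :
    toWord l z w = 0 := by
  obtain ⟨a, rfl⟩ := exists_eq_affElt l z
  induction a using AH_induction with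
  | add a b ha hb => rw [affElt_add, map_add, Pi.add_apply, ha, hb, add_zero]
  | mk g f => rw [toWord_affElt, if_neg (hw g)]

theorem affElt_eq_of_block_comp_eq {g g' : Equiv.Perm (Fin r)} (h : l.block ∘ g = l.block ∘ g')
    (a : AH k r) : affElt k l (permToAH k r g * a) = affElt k l (permToAH k r g' * a) := by
  have hg : g * g'⁻¹ ∈ l.young := fun p => by
    have := congrFun h (g'⁻¹ p)
    simpa using this
  rw [← affElt_young_mul l hg (permToAH k r g' * a), ← mul_assoc, ← map_mul,
    inv_mul_cancel_right]

theorem toWord_injective : Function.Injective (toWord (k := k) l) := by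
  classical
  -- a left inverse, built from a choice of permutations that produce the words
  let γ : (Fin r → Fin n) → Equiv.Perm (Fin r) := fun w =>
    if h : ∃ g : Equiv.Perm (Fin r), l.block ∘ g = w then h.choose else 1
  have hγ : ∀ g : Equiv.Perm (Fin r), l.block ∘ γ (l.block ∘ g) = l.block ∘ g := fun g => by
    have h : ∃ g' : Equiv.Perm (Fin r), l.block ∘ g' = l.block ∘ g := ⟨g, rfl⟩
    simp only [γ, dif_pos h]
    exact h.choose_spec
  refine Function.LeftInverse.injective
    (g := fun v => ∑ w, affElt k l (permToAH k r (γ w) * polyToAH k r (v w))) fun z => ?_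
  obtain ⟨a, rfl⟩ := exists_eq_affElt l z
  induction a using AH_induction with
  | add a b ha hb =>
    simp only [affElt_add, map_add, Pi.add_apply, mul_add, Finset.sum_add_distrib, ha, hb]
  | mk g f =>
    dsimp only
    rw [Finset.sum_eq_single (l.block ∘ g)]
    · rw [toWord_affElt, if_pos rfl]
      exact affElt_eq_of_block_comp_eq l (hγ g) _
    · intro w _ hw
      rw [toWord_affElt, if_neg hw, map_zero, mul_zero, ← zero_smul k (0 : AH k r), affElt_csmul,
        zero_smul]
    · exact fun h => absurd (Finset.mem_univ _) h

end ToWord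

/-! ### The invariant vectors -/

section XiVec

variable {k : Type u} [CommRing k] {n r : ℕ} {lam mu : Comp n r}

variable (k) in
/-- The vector `∑ m_lam ⊗ d_A f y` as a linear function of `f`. -/
noncomputable def xiVecLin (A : Mat lam mu) : MvPolynomial (Fin r) k →ₗ[k] AffMod k lam where
  toFun f := xiVec A f
  map_add' f g := by
    simp only [xiVec, map_add, mul_add, add_mul, affElt_add, Finset.sum_add_distrib]
  map_smul' c f := by
    simp only [xiVec, map_smul, mul_smul_comm, smul_mul_assoc, affElt_csmul, Finset.smul_sum,
      RingHom.id_apply]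

/-- The vectors defining `ξ_{A,f}` are invariant under `S_μ`. -/
theorem smul_xiVec (A : Mat lam mu) {f : MvPolynomial (Fin r) k}
    (hf : f ∈ invariants k (rightRed A)) {g : Equiv.Perm (Fin r)} (hg : g ∈ mu.young) :
    op (permToAH k r g) • xiVec A f = xiVec A f := by
  have h := sum_minRight_mul (rightRed A) mu.young (young_rightRed_le A)
    (fun y => affElt k lam (permToAH k r (dPerm A) * polyToAH k r f * permToAH k r y)) ?_ hg
  · simp only [map_mul, ← mul_assoc, affElt_mul _ _ (permToAH k r g)] at h
    rw [xiVec, Finset.smul_sum]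
    exact h
  · intro x hx y
    have hx' := ((mem_young_rightRed A).1 hx).2
    calc affElt k lam (permToAH k r (dPerm A) * polyToAH k r f * permToAH k r (x * y))
        = affElt k lam (permToAH k r (dPerm A * x) * (polyToAH k r f * permToAH k r y)) := by
          simp only [map_mul, mul_assoc]
          rw [← mul_assoc (polyToAH k r f), invariants_commute _ hf hx, mul_assoc]
      _ = _ := by
          rw [mul_assoc]
          exact affElt_eq_of_block_comp_eq lam (g := dPerm A * x) (g' := dPerm A) (funext hx') _

theorem toWord_xiVec (A : Mat lam mu) (f : MvPolynomial (Fin r) k) :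
    toWord lam (xiVec A f) = ∑ y ∈ minRight (rightRed A).young mu.young,
      (wordRep k n r (permToAH k r y)).unop
        (toWord lam (affElt k lam (permToAH k r (dPerm A) * polyToAH k r f))) := by
  simp only [xiVec, affElt_mul _ _ (permToAH k r _), map_sum, toWord_smul]

theorem toWord_affElt_mem_lowDeg {D : ℕ} (g : Equiv.Perm (Fin r)) {f : MvPolynomial (Fin r) k}
    (hD : f ∈ lowDeg k D) (w) :
    toWord lam (affElt k lam (permToAH k r g * polyToAH k r f)) w ∈ lowDeg k D := by
  rw [toWord_affElt]
  split_ifs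
  exacts [hD, zero_mem _]

theorem toWord_xiVec_mem_lowDeg {D : ℕ} (A : Mat lam mu) {f : MvPolynomial (Fin r) k}
    (hD : f ∈ lowDeg k (D + 1)) (w) : toWord lam (xiVec A f) w ∈ lowDeg k (D + 1) := by
  rw [toWord_xiVec, Finset.sum_apply]
  exact Submodule.sum_mem _ fun y _ =>
    wordRep_perm_mem_lowDeg (toWord_affElt_mem_lowDeg _ hD) y w

open Classical in
/-- The leading terms of the coefficients of the vectors `∑ m_lam ⊗ d_A f y` at the double coset
representatives `d_B`. -/
theorem toWord_xiVec_sub_mem_lowDeg {D : ℕ} (A B : Mat lam mu) {f : MvPolynomial (Fin r) k}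
    (hf : f ∈ invariants k (rightRed A)) (hD : f ∈ lowDeg k (D + 1)) :
    toWord lam (xiVec A f) (matWord B) - (if A = B then f else 0) ∈ lowDeg k D := by
  have hsum : ∑ y ∈ minRight (rightRed A).young mu.young,
      MvPolynomial.rename ⇑y⁻¹ (toWord lam
        (affElt k lam (permToAH k r (dPerm A) * polyToAH k r f)) (matWord B ∘ ⇑y⁻¹)) =
      if A = B then f else 0 := by
    simp only [toWord_affElt]
    split_ifs with hAB
    · subst hAB
      -- only the representative of the trivial coset contributes
      obtain ⟨z, ⟨hz, hz1⟩, huniq⟩ := existsUnique_minRight (rightRed A) mu.young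
        (young_rightRed_le A) (one_mem _)
      rw [inv_one, mul_one] at hz1
      rw [Finset.sum_eq_single z]
      · rw [if_pos, hf _ (inv_mem hz1)]
        exact funext ((mem_young_rightRed A).1 (inv_mem hz1)).2
      · intro y hy hyz
        rw [if_neg, map_zero]
        intro e
        have hy' := ((mem_minRight _).1 hy).1
        refine hyz (huniq y ⟨hy, ?_⟩)
        rw [inv_one, mul_one]
        exact inv_mem_iff.1 ((mem_young_rightRed A).2 ⟨inv_mem hy', congrFun e⟩)
      · exact fun h => absurd hz h
    · refine Finset.sum_eq_zero fun y hy => ?_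
      rw [if_neg, map_zero]
      exact fun e => hAB (mat_eq_of_matWord (inv_mem ((mem_minRight _).1 hy).1) (congrFun e)).symm
  rw [← hsum, toWord_xiVec, Finset.sum_apply, ← Finset.sum_sub_distrib]
  exact Submodule.sum_mem _ fun y _ =>
    wordRep_perm_sub_mem_lowDeg (toWord_affElt_mem_lowDeg _ hD) y _

noncomputable instance : Fintype (Mat lam mu) := Fintype.ofFinite _

variable (k lam mu) in
/-- The map `(f_A)_A ↦ ∑_A ∑_y m_lam ⊗ d_A f_A y`. -/
noncomputable def xiSum :
    ((A : Mat lam mu) → invariants k (rightRed A)) →ₗ[k] AffMod k lam :=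
  ∑ A, xiVecLin k A ∘ₗ (invariants k (rightRed A)).val.toLinearMap ∘ₗ LinearMap.proj A

theorem xiSum_apply (f : (A : Mat lam mu) → invariants k (rightRed A)) :
    xiSum k lam mu f = ∑ A, xiVec A (f A).1 := by
  rw [xiSum, LinearMap.sum_apply]
  rfl

theorem toWord_xiSum (f : (A : Mat lam mu) → invariants k (rightRed A)) (w) :
    toWord lam (xiSum k lam mu f) w = ∑ A, toWord lam (xiVec A (f A).1) w := by
  rw [xiSum_apply, map_sum, Finset.sum_apply]

theorem toWord_xiSum_sub_mem_lowDeg {D : ℕ} (f : (A : Mat lam mu) → invariants k (rightRed A))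
    (hD : ∀ A, (f A).1 ∈ lowDeg k (D + 1)) (B : Mat lam mu) :
    toWord lam (xiSum k lam mu f) (matWord B) - (f B).1 ∈ lowDeg k D := by
  classical
  have : (f B).1 = ∑ A, if A = B then (f A).1 else 0 := by simp
  rw [toWord_xiSum, this, ← Finset.sum_sub_distrib]
  exact Submodule.sum_mem _ fun A _ => toWord_xiVec_sub_mem_lowDeg A B (f A).2 (hD A)

theorem xiSum_injective : Function.Injective (xiSum k lam mu) := by
  rw [injective_iff_map_eq_zero]
  intro f hf
  have key : ∀ D, (∀ A, (f A).1 ∈ lowDeg k D) → f = 0 := by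
    intro D hD
    induction D with
    | zero => exact funext fun A => Subtype.ext (eq_zero_of_mem_lowDeg_zero (hD A))
    | succ D ih =>
      refine ih fun A => ?_
      have := toWord_xiSum_sub_mem_lowDeg f hD A
      rwa [hf, map_zero, Pi.zero_apply, zero_sub, neg_mem_iff] at this
  refine key (Finset.univ.sup fun A => (f A).1.totalDegree + 1) fun A => ?_
  exact lowDeg_mono (Finset.le_sup (f := fun A => (f A).1.totalDegree + 1) (Finset.mem_univ A))
    (mem_lowDeg_totalDegree _)

/-- Every `S_μ`-invariant vector is a sum of the vectors `∑ m_lam ⊗ d_A f y`; by induction on the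
degree, subtracting the vectors with the same leading terms at the words of matrices. -/
theorem mem_range_xiSum (z : AffMod k lam)
    (hz : ∀ g ∈ mu.young, op (permToAH k r g) • z = z) :
    z ∈ LinearMap.range (xiSum k lam mu) := by
  have key : ∀ D, ∀ z : AffMod k lam, (∀ g ∈ mu.young, op (permToAH k r g) • z = z) →
      (∀ w, toWord lam z w ∈ lowDeg k D) → z ∈ LinearMap.range (xiSum k lam mu) := by
    intro D
    induction D with
    | zero =>
      intro z _ hD
      have : toWord lam z = toWord lam 0 := by
        rw [map_zero]
        exact funext fun w => eq_zero_of_mem_lowDeg_zero (hD w)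
      rw [toWord_injective lam this]
      exact zero_mem _
    | succ D ih =>
      intro z hz hD
      -- the leading terms of the equation `z g = z`
      have hlead : ∀ g ∈ mu.young, ∀ w,
          toWord lam z w - MvPolynomial.rename ⇑g⁻¹ (toWord lam z (w ∘ ⇑g⁻¹)) ∈ lowDeg k D := by
        intro g hg w
        have := wordRep_perm_sub_mem_lowDeg hD g w
        rwa [← toWord_smul, hz g hg] at this
      let f : (A : Mat lam mu) → invariants k (rightRed A) := fun A =>
        ⟨MvPolynomial.homogeneousComponent D (toWord lam z (matWord A)), fun g hg => by
          have h1 := hlead g⁻¹ (inv_mem (young_rightRed_le A hg)) (matWord A)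
          rw [inv_inv, show matWord A ∘ g = matWord A from
            funext ((mem_young_rightRed A).1 hg).2] at h1
          have h2 := homogeneousComponent_eq_zero_of_mem_lowDeg h1
          rw [map_sub, sub_eq_zero] at h2
          rw [MvPolynomial.rename_homogeneousComponent, ← h2]⟩
      have hfD : ∀ A, (f A).1 ∈ lowDeg k (D + 1) := fun A => homogeneousComponent_mem_lowDeg _ _
      have hf := LinearMap.mem_range_self (xiSum k lam mu) f
      suffices z - xiSum k lam mu f ∈ LinearMap.range (xiSum k lam mu) by
        simpa using add_mem this hf
      have hinv : ∀ g ∈ mu.young,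
          op (permToAH k r g) • (z - xiSum k lam mu f) = z - xiSum k lam mu f := by
        intro g hg
        rw [smul_sub, hz g hg, xiSum_apply, Finset.smul_sum]
        simp only [smul_xiVec _ (f _).2 hg]
      refine ih _ hinv fun w => ?_
      have hD' : ∀ w, toWord lam (z - xiSum k lam mu f) w ∈ lowDeg k (D + 1) := fun w => by
        rw [map_sub, Pi.sub_apply, toWord_xiSum]
        exact sub_mem (hD w) (Submodule.sum_mem _ fun A _ => toWord_xiVec_mem_lowDeg A (hfD A) w)
      have hA : ∀ A : Mat lam mu,
          toWord lam (z - xiSum k lam mu f) (matWord A) ∈ lowDeg k D := fun A => by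
        have := sub_mem (sub_homogeneousComponent_mem_lowDeg (hD (matWord A)))
          (toWord_xiSum_sub_mem_lowDeg f hfD A)
        rw [map_sub, Pi.sub_apply]
        convert this using 1
        simp only [f]
        ring
      -- a word of content `λ` is moved by `S_μ` to the word of a matrix; no other words occur
      by_cases hw : ∃ g : Equiv.Perm (Fin r), w = lam.block ∘ g
      · obtain ⟨g, rfl⟩ := hw
        obtain ⟨A, y, hy, hAy⟩ := exists_matWord (lam := lam) (mu := mu) g
        have h1 := wordRep_perm_sub_mem_lowDeg hD' y (lam.block ∘ g)
        rw [← toWord_smul, hinv y hy, (comp_perm_eq_iff (w := lam.block ∘ g)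
          (w' := matWord A) y).2 (funext fun p => (hAy p).symm)] at h1
        have := add_mem h1 (rename_mem_lowDeg y⁻¹ (hA A))
        rwa [sub_add_cancel] at this
      · push Not at hw
        rw [toWord_eq_zero lam _ w hw]
        exact zero_mem _
  refine key (Finset.univ.sup fun w => (toWord lam z w).totalDegree + 1) z hz fun w => ?_
  exact lowDeg_mono (Finset.le_sup (f := fun w => (toWord lam z w).totalDegree + 1)
    (Finset.mem_univ w)) (mem_lowDeg_totalDegree _)

end XiVec

/-! ### Invariant polynomials form a free module -/

section Free

variable (k : Type u) [CommRing k] {n r : ℕ} (l : Comp n r)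

/-- Exponents are equivalent if a permutation in `S_l` maps one to the other. -/
def expSetoid : Setoid (Fin r →₀ ℕ) where
  r m m' := ∃ g ∈ l.young, m.mapDomain g = m'
  iseqv :=
    { refl := fun m => ⟨1, one_mem _, Finsupp.mapDomain_id⟩
      symm := by
        rintro m _ ⟨g, hg, rfl⟩
        refine ⟨g⁻¹, inv_mem hg, ?_⟩
        rw [← Finsupp.mapDomain_comp, ← Equiv.Perm.coe_mul, inv_mul_cancel]
        exact Finsupp.mapDomain_id
      trans := by
        rintro m _ _ ⟨g, hg, rfl⟩ ⟨g', hg', rfl⟩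
        exact ⟨g' * g, mul_mem hg' hg, by rw [← Finsupp.mapDomain_comp, Equiv.Perm.coe_mul]⟩ }

variable {k l}

theorem coeff_eq_of_mem_invariants {f : MvPolynomial (Fin r) k} (hf : f ∈ invariants k l)
    {m m' : Fin r →₀ ℕ} (h : expSetoid l m m') : f.coeff m' = f.coeff m := by
  obtain ⟨g, hg, rfl⟩ := h
  conv_lhs => rw [← hf g hg]
  exact MvPolynomial.coeff_rename_mapDomain _ g.injective _ _

variable (k l)

/-- The monomial symmetric functions of `S_l` form a basis of the invariants; here in the form of
the coordinates of an invariant polynomial, its coefficients at the orbits of exponents. -/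
theorem free_invariants : Module.Free k (invariants k l) := by
  classical
  let c : invariants k l →ₗ[k] (Quotient (expSetoid l) →₀ k) :=
    { toFun := fun f => Finsupp.ofSupportFinite (fun q => f.1.coeff q.out)
        ((f.1.support.finite_toSet.preimage
          (Quotient.out_injective (s := expSetoid l)).injOn).subset fun q hq => by
            simpa using hq)
      map_add' := fun f g => Finsupp.ext fun q => MvPolynomial.coeff_add _ _ _
      map_smul' := fun a f => Finsupp.ext fun q => MvPolynomial.coeff_smul _ _ _ }
  have hc : ∀ (f : invariants k l) m, f.1.coeff m = c f (Quotient.mk _ m) := fun f m =>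
    coeff_eq_of_mem_invariants f.2 (Quotient.mk_out (s := expSetoid l) m)
  refine Module.Free.of_equiv (LinearEquiv.ofBijective c ⟨fun f g hfg => ?_, fun h => ?_⟩).symm
  · exact Subtype.ext (MvPolynomial.ext _ _ fun m => by rw [hc, hc, hfg])
  · let S : Finset (Fin r →₀ ℕ) := h.support.biUnion fun q =>
      (Finset.univ.filter (· ∈ l.young)).image fun g => q.out.mapDomain g
    let p : MvPolynomial (Fin r) k := ∑ m ∈ S, MvPolynomial.monomial m (h (Quotient.mk _ m))
    have hp : ∀ m, p.coeff m = h (Quotient.mk _ m) := by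
      intro m
      simp only [p, MvPolynomial.coeff_sum, MvPolynomial.coeff_monomial, Finset.sum_ite_eq']
      split_ifs with hm
      · rfl
      · by_contra hne
        refine hm (Finset.mem_biUnion.2 ⟨Quotient.mk _ m, Finsupp.mem_support_iff.2 (Ne.symm hne),
          Finset.mem_image.2 ?_⟩)
        obtain ⟨g, hg, e⟩ := Quotient.mk_out (s := expSetoid l) m
        exact ⟨g, by simpa using hg, e⟩
    have hinv : p ∈ invariants k l := fun g hg => MvPolynomial.ext _ _ fun m => by
      obtain ⟨m, rfl⟩ : ∃ m', m = Finsupp.mapDomain g m' :=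
        ⟨m.mapDomain ⇑g⁻¹, by
          rw [← Finsupp.mapDomain_comp, ← Equiv.Perm.coe_mul, mul_inv_cancel]
          exact Finsupp.mapDomain_id.symm⟩
      rw [MvPolynomial.coeff_rename_mapDomain _ g.injective, hp, hp]
      congr 1
      exact Quotient.sound ⟨g, hg, rfl⟩
    refine ⟨⟨p, hinv⟩, Finsupp.ext fun q => ?_⟩
    induction q using Quotient.inductionOn with
    | h m => rw [← hc]; exact hp m

end Free

/-! ### Homomorphisms and the corners of the Schur algebra -/

section Hom

variable (k : Type u) [CommRing k] {n r : ℕ} (lam mu : Comp n r)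

/-- The evaluation of a homomorphism at the generator `m_mu ⊗ 1`. -/
noncomputable def evalGen : AffHom k mu lam →ₗ[k] AffMod k lam where
  toFun F := F (affElt k mu 1)
  map_add' _ _ := rfl
  map_smul' _ _ := rfl

theorem evalGen_injective : Function.Injective (evalGen k lam mu) :=
  fun _ _ h => affHom_ext mu h

theorem exists_xi (A : Mat lam mu) (f : invariants k (rightRed A)) :
    ∃ F : AffHom k mu lam, evalGen k lam mu F = xiVec A f.1 :=
  exists_affHom _ fun _ hg => smul_xiVec A f.2 hg

theorem smul_evalGen (F : AffHom k mu lam) {g : Equiv.Perm (Fin r)} (hg : g ∈ mu.young) :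
    op (permToAH k r g) • evalGen k lam mu F = evalGen k lam mu F := by
  change _ • F _ = F _
  rw [← map_smul, ← affElt_mul, one_mul, ← mul_one (permToAH k r g), affElt_young_mul mu hg]

/-- The homomorphism `ξ_{A,f}`. -/
noncomputable def xi (A : Mat lam mu) (f : invariants k (rightRed A)) : AffHom k mu lam :=
  (exists_xi k lam mu A f).choose

theorem evalGen_xi (A : Mat lam mu) (f : invariants k (rightRed A)) :
    evalGen k lam mu (xi k lam mu A f) = xiVec A f.1 :=
  (exists_xi k lam mu A f).choose_spec

/-- Evaluation at the generator identifies the homomorphisms with the `S_μ`-invariant vectors, and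
these with the families of invariant polynomials. -/
theorem exists_xiEquiv :
    ∃ e : ((A : Mat lam mu) → invariants k (rightRed A)) ≃ₗ[k] AffHom k mu lam,
      ∀ f, evalGen k lam mu (e f) = xiSum k lam mu f := by
  have hrange : LinearMap.range (xiSum k lam mu) = LinearMap.range (evalGen k lam mu) := by
    apply le_antisymm
    · rintro _ ⟨f, rfl⟩
      rw [xiSum_apply]
      exact Submodule.sum_mem _ fun A _ => ⟨xi k lam mu A (f A), evalGen_xi k lam mu A (f A)⟩
    · rintro _ ⟨F, rfl⟩
      exact mem_range_xiSum _ fun g hg => smul_evalGen k lam mu F hg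
  let e₁ := LinearEquiv.ofInjective _ (xiSum_injective (k := k) (lam := lam) (mu := mu))
  let e₂ := LinearEquiv.ofInjective _ (evalGen_injective k lam mu)
  let e := (e₁.trans (LinearEquiv.ofEq _ _ hrange)).trans e₂.symm
  refine ⟨e, fun f => ?_⟩
  change (e₂ (e₂.symm _)).1 = _
  rw [LinearEquiv.apply_symm_apply]
  rfl

theorem compMap_bijective :
    Function.Bijective ((compMap k lam mu).domRestrict (corner k lam mu)) := by
  constructor
  · rw [injective_iff_map_eq_zero]
    rintro ⟨_, a, rfl⟩ h
    have h' : ∀ z, (a (DirectSum.lof (AH k r)ᵐᵒᵖ (Comp n r) (fun l => AffMod k l) mu z)) lam = 0 := by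
      intro z
      have := LinearMap.congr_fun h z
      simp only [LinearMap.zero_apply] at this
      simpa [compMap, idem, DirectSum.component.lof_self] using! this
    refine Subtype.ext (LinearMap.ext fun x => ?_)
    change DirectSum.lof (AH k r)ᵐᵒᵖ (Comp n r) (fun l => AffMod k l) lam
      ((a (DirectSum.lof (AH k r)ᵐᵒᵖ (Comp n r) (fun l => AffMod k l) mu _)) lam) = 0
    rw [h', map_zero]
  · intro F
    let a : AS k n r := DirectSum.lof (AH k r)ᵐᵒᵖ (Comp n r) (fun l => AffMod k l) lam ∘ₗ F ∘ₗ
      DirectSum.component (AH k r)ᵐᵒᵖ (Comp n r) (fun l => AffMod k l) mu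
    refine ⟨⟨_, a, rfl⟩, LinearMap.ext fun z => ?_⟩
    simp [compMap, idem, a, DirectSum.component.lof_self]

end Hom

end DegAffSchur

theorem theorem3p2 (k : Type u) [CommRing k] (n r : ℕ) (lam mu : DegAffSchur.Comp n r) :
    -- taking components identifies `1_lam AS(n,r) 1_mu` with the space of homomorphisms
    Function.Bijective
      ((DegAffSchur.compMap k lam mu).domRestrict (DegAffSchur.corner k lam mu)) ∧
    -- which is a free `k`-module
    Module.Free k (DegAffSchur.AffHom k mu lam) ∧
    -- the invariants `P^{μ(A)}` have bases
    (∀ A : DegAffSchur.Mat lam mu,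
      Module.Free k (DegAffSchur.invariants k (DegAffSchur.rightRed A))) ∧
    -- there is a unique homomorphism `ξ_{A,f}` with the prescribed value on `m_mu ⊗ 1`
    ∃ ξ : (A : DegAffSchur.Mat lam mu) → DegAffSchur.invariants k (DegAffSchur.rightRed A) →
        DegAffSchur.AffHom k mu lam,
      (∀ A f, ξ A f (DegAffSchur.affElt k mu 1) = DegAffSchur.xiVec A f.1 ∧
        ∀ φ : DegAffSchur.AffHom k mu lam,
          φ (DegAffSchur.affElt k mu 1) = DegAffSchur.xiVec A f.1 → φ = ξ A f) ∧
      -- and these homomorphisms form a basis when `f` runs over a basis of `P^{μ(A)}`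
      ∀ (ι : DegAffSchur.Mat lam mu → Type v)
        (b : (A : DegAffSchur.Mat lam mu) →
          Module.Basis (ι A) k (DegAffSchur.invariants k (DegAffSchur.rightRed A))),
        ∃ B : Module.Basis (Σ A, ι A) k (DegAffSchur.AffHom k mu lam),
          ∀ A i, B ⟨A, i⟩ = ξ A (b A i) := by
  classical
  obtain ⟨e, he⟩ := DegAffSchur.exists_xiEquiv k lam mu
  have hfree := fun A : DegAffSchur.Mat lam mu =>
    DegAffSchur.free_invariants k (DegAffSchur.rightRed A)
  have hxi := DegAffSchur.evalGen_xi k lam mu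
  refine ⟨DegAffSchur.compMap_bijective k lam mu, Module.Free.of_equiv e, hfree,
    DegAffSchur.xi k lam mu, fun A f => ⟨hxi A f, fun φ hφ =>
      DegAffSchur.evalGen_injective k lam mu (hφ.trans (hxi A f).symm)⟩, fun ι b => ?_⟩
  refine ⟨(Pi.basis b).map e, fun A i => DegAffSchur.evalGen_injective k lam mu ?_⟩
  rw [Module.Basis.map_apply, Pi.basis_apply, he, hxi, DegAffSchur.xiSum_apply,
    Finset.sum_eq_single A]
  · rw [Pi.single_eq_same]
  · intro A' _ hA'
    rw [Pi.single_eq_of_ne hA']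
    exact map_zero (DegAffSchur.xiVecLin k A')
  · exact fun h => absurd (Finset.mem_univ _) h
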